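/- Let $m,n\ge 1$ be integers, let $\mathbb F_n^+$ be the free semigroup on generators $g_1,\dots,g_n$ with unit $g_0$, and let $f=\sum_{\alpha\in\mathbb F_n^+}a_\alpha X_\alpha$ be a positive regular free holomorphic function on $\{X\in B(\mathcal H)^n:\ \|X_1X_1^*+\cdots+X_nX_n^*\|<\rho\}$ for some $\rho>0$ and some Hilbert space $\mathcal H\neq\{0\}$; that is, $a_\alpha\ge 0$ for all $\alpha$, $a_{g_0}=0$, $a_{g_i}>0$ for $i=1,\dots,n$, and $\sum_{k\ge0}\sum_{|\alpha|=k}a_\alpha X_\alpha$ converges in operator norm at every point of this ball. Put $b^{(m)}_{g_0}=1$ and $$b^{(m)}_\alpha=\sum_{j=1}^{|\alpha|}\ \sum_{\gamma_1\cdots\gamma_j=\alpha,\ |\gamma_i|\ge1}a_{\gamma_1}\cdots a_{\gamma_j}\binom{j+m-1}{m-1}\qquad(|\alpha|\ge1).$$ For $\mathbf k\in\mathbb N_0^n$ let $\Lambda_{\mathbf k}$ be the set of words in which each $g_i$ occurs exactly $k_i$ times, and let $\gamma^{(m)}_{\mathbf k}=\sum_{\alpha\in\Lambda_{\mathbf k}}b^{(m)}_\alpha$.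 Let $${\bf D}^1_{f,\circ}(\mathbb C)=\Big\{\lambda\in\mathbb C^n:\ \sum_{|\alpha|\ge1}a_\alpha|\lambda_\alpha|^2<1\Big\},$$ and let $H^2({\bf D}^1_{f,\circ}(\mathbb C))$ be the Hilbert space of all functions $\varphi$ on ${\bf D}^1_{f,\circ}(\mathbb C)$ that admit a power series representation $\varphi(\lambda)=\sum_{\mathbf k}c_{\mathbf k}\lambda^{\mathbf k}$ there with $\|\varphi\|_2^2=\sum_{\mathbf k}|c_{\mathbf k}|^2/\gamma^{(m)}_{\mathbf k}<\infty$. Let $H^\infty({\bf D}^1_{f,\circ}(\mathbb C))\subset B(H^2({\bf D}^1_{f,\circ}(\mathbb C)))$ be the algebra of all its multipliers, i.e. of all bounded operators of multiplication by a function on ${\bf D}^1_{f,\circ}(\mathbb C)$. On the full Fock space $F^2(H_n)$ with orthonormal basis $(e_\alpha)_{\alpha\in\mathbb F_n^+}$ let $W_ie_\alpha=\sqrt{b^{(m)}_\alpha/b^{(m)}_{g_i\alpha}}\;e_{g_i\alpha}$, let $F^2_s$ be the closed span of the vectors $w^{\mathbf k}=\frac1{\gamma^{(m)}_{\mathbf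 k}}\sum_{\alpha\in\Lambda_{\mathbf k}}\sqrt{b^{(m)}_\alpha}\,e_\alpha$, and let $L_i=P_{F^2_s}W_i|_{F^2_s}$, $i=1,\dots,n$. Then the map $U:\varphi\mapsto\big(\lambda\mapsto\sum_\alpha\langle\varphi,e_\alpha\rangle\sqrt{b^{(m)}_\alpha}\,\lambda_\alpha\big)$ is a unitary operator from $F^2_s$ onto $H^2({\bf D}^1_{f,\circ}(\mathbb C))$, under which $L_i$ becomes the operator of multiplication by the coordinate function $\lambda_i$. With this identification, the algebra $H^\infty({\bf D}^1_{f,\circ}(\mathbb C))$ is reflexive, i.e. it consists of all bounded operators on $H^2({\bf D}^1_{f,\circ}(\mathbb C))$ that leave invariant every closed subspace invariant under all of $H^\infty({\bf D}^1_{f,\circ}(\mathbb C))$, and it coincides with the smallest algebra of operators that contains $L_1,\dots,L_n$ and the identity and is closed in the weak operator topology. -/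

import Mathlib

open Filter Topology
open scoped lp ComplexConjugate

namespace FockDomain

noncomputable section

/-! ### Words and positive regular free holomorphic functions -/

/-- The free semigroup on `n` generators: words `g_{i₁} ⋯ g_{i_k}` are lists `[i₁, …, i_k]`, the
product is concatenation `++`, the unit is `[]`, the length of a word is `List.length`. -/
abbrev Word (n : ℕ) : Type := List (Fin n)

/-- `evalWord x α = x_{i₁} ⋯ x_{i_k}` for `α = g_{i₁} ⋯ g_{i_k}`, and `1` for the empty word. -/
def evalWord {n : ℕ} {R : Type*} [Monoid R] (x : Fin n → R) (α : Word n) : R :=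
  (α.map x).prod

/-- A positive regular free holomorphic function `f = ∑ a_α X_α` on the noncommutative ball
`{(X₁, …, Xₙ) ∈ B(H)ⁿ : ‖X₁X₁* + ⋯ + XₙXₙ*‖ < ρ}` for some `ρ > 0`: the coefficients satisfy
`a_α ≥ 0`, `a_{g₀} = 0`, `a_{g_i} > 0`, and the series `∑_k ∑_{|α| = k} a_α X_α` converges in
the operator norm at each point of the ball. The words of length `k` are listed as
`List.ofFn v`, `v : Fin k → Fin n`. -/
structure PosRegFreeHol (n : ℕ) (H : Type*) [NormedAddCommGroup H] [InnerProductSpace ℂ H]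
    [CompleteSpace H] where
  /-- the coefficients `a_α` -/
  coeff : Word n → ℝ
  /-- the size of the ball -/
  ρ : ℝ
  ρ_pos : 0 < ρ
  coeff_nonneg : ∀ α, 0 ≤ coeff α
  coeff_nil : coeff [] = 0
  coeff_gen_pos : ∀ i, 0 < coeff [i]
  converges : ∀ X : Fin n → (H →L[ℂ] H),
    ‖∑ i, X i * ContinuousLinearMap.adjoint (X i)‖ < ρ →
      ∃ Y : H →L[ℂ] H, Tendsto
        (fun N : ℕ => ∑ k ∈ Finset.range N, ∑ v : Fin k → Fin n,
          (coeff (List.ofFn v) : ℂ) • evalWord X (List.ofFn v)) atTop (𝓝 Y)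

variable {n : ℕ} {H : Type*} [NormedAddCommGroup H] [InnerProductSpace ℂ H] [CompleteSpace H]

/-- The scalar domain `{λ ∈ ℂⁿ : ∑_{|α| ≥ 1} a_α |λ_α|² < 1}` (the sum may be taken over all
words since `a_{g₀} = 0`; it is required to converge). -/
def scalarDomain (f : PosRegFreeHol n H) : Set (Fin n → ℂ) :=
  {x | Summable (fun α : Word n => f.coeff α * ‖evalWord x α‖ ^ 2) ∧
    ∑' α : Word n, f.coeff α * ‖evalWord x α‖ ^ 2 < 1}

/-- The coefficients
`b_α^{(m)} = ∑_j ∑_{γ₁ ⋯ γ_j = α, |γ_i| ≥ 1} a_{γ₁} ⋯ a_{γ_j} (j + m - 1 choose m - 1)`.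
A factorization of `α` into `j` nonempty words is a composition of the number `|α|` into `j`
parts. For the empty word the only composition has no parts, and `b_{g₀}^{(m)} = 1`. -/
def bCoeff (f : PosRegFreeHol n H) (m : ℕ) (α : Word n) : ℝ :=
  ∑ c : Composition α.length,
    ((α.splitWrtComposition c).map f.coeff).prod * ((c.length + m - 1).choose (m - 1) : ℝ)

/-- The set `Λ_k` of the words in which each generator `g_i` occurs exactly `k i` times. -/
def wordsOfType (k : Fin n →₀ ℕ) : Finset (Word n) :=
  (Multiset.lists (Finsupp.toMultiset k)).toFinset

theorem mem_wordsOfType (k : Fin n →₀ ℕ) (α : Word n) :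
    α ∈ wordsOfType k ↔ ∀ i, α.count i = k i := by
  rw [wordsOfType, Multiset.mem_toFinset, Multiset.mem_lists_iff]
  change Finsupp.toMultiset k = (α : Multiset (Fin n)) ↔ _
  rw [Multiset.ext]
  simp only [Finsupp.count_toMultiset, Multiset.coe_count]
  exact forall_congr' fun _ => eq_comm

/-- `γ_k^{(m)} = ∑_{α ∈ Λ_k} b_α^{(m)}`. -/
def gammaCoeff (f : PosRegFreeHol n H) (m : ℕ) (k : Fin n →₀ ℕ) : ℝ :=
  ∑ α ∈ wordsOfType k, bCoeff f m α

/-! ### Elementary facts about the coefficients -/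

theorem prod_coeff_nonneg (f : PosRegFreeHol n H) (l : List (Word n)) :
    0 ≤ (l.map f.coeff).prod := by
  apply List.prod_nonneg
  intro x hx
  obtain ⟨α, -, rfl⟩ := List.mem_map.1 hx
  exact f.coeff_nonneg α

theorem bCoeff_nonneg (f : PosRegFreeHol n H) (m : ℕ) (α : Word n) : 0 ≤ bCoeff f m α :=
  Finset.sum_nonneg fun _ _ => mul_nonneg (prod_coeff_nonneg f _) (Nat.cast_nonneg _)

theorem bCoeff_nil (f : PosRegFreeHol n H) (m : ℕ) : bCoeff f m [] = 1 := by
  have : ∀ c : Composition ([] : Word n).length,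
      ((([] : Word n).splitWrtComposition c).map f.coeff).prod *
        ((c.length + m - 1).choose (m - 1) : ℝ) = 1 := by
    intro c
    have hl : c.blocks = [] := by
      rcases hb : c.blocks with _ | ⟨x, l⟩
      · rfl
      · have h1 := c.blocks_sum
        have h2 : 0 < x := c.blocks_pos (by simp [hb])
        rw [hb] at h1
        simp at h1
        omega
    simp [List.splitWrtComposition, List.splitWrtCompositionAux, Composition.length, hl]
  rw [bCoeff, Finset.sum_congr rfl (fun c _ => this c)]
  simp [Finset.card_univ, composition_card]

/-- `a_{g_i} b_α ≤ b_{g_i α}`. -/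
theorem coeff_mul_bCoeff_le (f : PosRegFreeHol n H) (m : ℕ) (i : Fin n) (α : Word n) :
    f.coeff [i] * bCoeff f m α ≤ bCoeff f m (i :: α) := by
  let e : Composition α.length → Composition (i :: α).length := fun c =>
    { blocks := 1 :: c.blocks
      blocks_pos := by
        intro j hj
        rcases List.mem_cons.1 hj with h | h
        · omega
        · exact c.blocks_pos h
      blocks_sum := by
        have := c.blocks_sum
        simp [this, add_comm] }
  have he : Function.Injective e := by
    intro c d h
    have : (e c).blocks = (e d).blocks := by rw [h]
    apply Composition.ext
    simpa [e] using this
  calc f.coeff [i] * bCoeff f m α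
      ≤ ∑ c : Composition α.length, (((i :: α).splitWrtComposition (e c)).map f.coeff).prod *
          (((e c).length + m - 1).choose (m - 1) : ℝ) := by
        rw [bCoeff, Finset.mul_sum]
        apply Finset.sum_le_sum
        intro c _
        have h1 : (((i :: α).splitWrtComposition (e c)).map f.coeff).prod =
            f.coeff [i] * ((α.splitWrtComposition c).map f.coeff).prod := by
          simp [List.splitWrtComposition, e, List.splitWrtCompositionAux]
        rw [h1, mul_assoc]
        have h2 : (c.length + m - 1).choose (m - 1) ≤ ((e c).length + m - 1).choose (m - 1) := by
          apply Nat.choose_le_choose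
          simp only [Composition.length, e, List.length_cons]
          omega
        have h2' : ((c.length + m - 1).choose (m - 1) : ℝ) ≤
            (((e c).length + m - 1).choose (m - 1) : ℝ) := by exact_mod_cast h2
        exact mul_le_mul_of_nonneg_left
          (mul_le_mul_of_nonneg_left h2' (prod_coeff_nonneg f _)) (f.coeff_nonneg _)
    _ = ∑ d ∈ Finset.univ.map ⟨e, he⟩, (((i :: α).splitWrtComposition d).map f.coeff).prod *
          ((d.length + m - 1).choose (m - 1) : ℝ) := by
        rw [Finset.sum_map]
        rfl
    _ ≤ bCoeff f m (i :: α) :=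
        Finset.sum_le_sum_of_subset_of_nonneg (Finset.subset_univ _)
          fun _ _ _ => mul_nonneg (prod_coeff_nonneg f _) (Nat.cast_nonneg _)

theorem bCoeff_pos (f : PosRegFreeHol n H) (m : ℕ) (α : Word n) : 0 < bCoeff f m α := by
  induction α with
  | nil => simp [bCoeff_nil]
  | cons i α ih => exact (mul_pos (f.coeff_gen_pos i) ih).trans_le (coeff_mul_bCoeff_le f m i α)

theorem gammaCoeff_pos (f : PosRegFreeHol n H) (m : ℕ) (k : Fin n →₀ ℕ) :
    0 < gammaCoeff f m k := by
  apply Finset.sum_pos (fun α _ => bCoeff_pos f m α)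
  obtain ⟨l, hl⟩ := Quot.exists_rep (Finsupp.toMultiset k)
  exact ⟨l, by
    rw [wordsOfType, Multiset.mem_toFinset, Multiset.mem_lists_iff]
    exact hl.symm⟩

/-! ### The Fock space, the weighted left creation operators, the symmetric Fock space -/

/-- The full Fock space with `n` generators, with orthonormal basis `e_α`, `α` a word. -/
abbrev Fock (n : ℕ) : Type := lp (fun _ : Word n => ℂ) 2

/-- The basis vector `e_α`. -/
def basisVec (α : Word n) : Fock n := lp.single 2 α (1 : ℂ)

/-- The coordinates of `W_i φ`: since `W_i e_α = √(b_α / b_{g_i α}) e_{g_i α}`, the coordinate at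
`g_i α` is `√(b_α / b_{g_i α}) φ_α`, and it is `0` at words that do not begin with `g_i`. -/
def creationFun (f : PosRegFreeHol n H) (m : ℕ) (i : Fin n) (φ : Word n → ℂ) : Word n → ℂ
  | [] => 0
  | j :: α => if j = i then
      ((Real.sqrt (bCoeff f m α) / Real.sqrt (bCoeff f m (i :: α)) : ℝ) : ℂ) * φ α else 0

theorem weight_sq_le (f : PosRegFreeHol n H) (m : ℕ) (i : Fin n) (α : Word n) :
    (Real.sqrt (bCoeff f m α) / Real.sqrt (bCoeff f m (i :: α))) ^ 2 ≤ (f.coeff [i])⁻¹ := by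
  rw [div_pow, Real.sq_sqrt (bCoeff_nonneg f m _), Real.sq_sqrt (bCoeff_nonneg f m _),
    div_le_iff₀ (bCoeff_pos f m _), inv_mul_eq_div, le_div_iff₀ (f.coeff_gen_pos i), mul_comm]
  exact coeff_mul_bCoeff_le f m i α

theorem creationFun_hasSum (f : PosRegFreeHol n H) (m : ℕ) (i : Fin n) (φ : Fock n) :
    Summable (fun β => ‖creationFun f m i φ β‖ ^ 2) ∧
      ∑' β, ‖creationFun f m i φ β‖ ^ 2 ≤ (f.coeff [i])⁻¹ * ‖φ‖ ^ 2 := by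
  have hφ : HasSum (fun α => ‖φ α‖ ^ 2) (‖φ‖ ^ 2) := by
    have := lp.hasSum_norm (p := 2) (by norm_num) φ
    simpa using this
  have hinj : Function.Injective (fun α : Word n => i :: α) := fun _ _ h => (List.cons.inj h).2
  have hsupp : ∀ β, β ∉ Set.range (fun α : Word n => i :: α) →
      ‖creationFun f m i φ β‖ ^ 2 = 0 := by
    intro β hβ
    rcases β with _ | ⟨j, α⟩
    · simp [creationFun]
    · have : j ≠ i := by
        rintro rfl
        exact hβ ⟨α, rfl⟩
      simp [creationFun, this]
  have hle : ∀ α, ‖creationFun f m i φ (i :: α)‖ ^ 2 ≤ (f.coeff [i])⁻¹ * ‖φ α‖ ^ 2 := by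
    intro α
    have : ‖creationFun f m i φ (i :: α)‖ ^ 2 =
        (Real.sqrt (bCoeff f m α) / Real.sqrt (bCoeff f m (i :: α))) ^ 2 * ‖φ α‖ ^ 2 := by
      simp only [creationFun, if_true, norm_mul, mul_pow, Complex.norm_real, Real.norm_eq_abs,
        sq_abs]
    rw [this]
    exact mul_le_mul_of_nonneg_right (weight_sq_le f m i α) (sq_nonneg _)
  have hs : Summable (fun α => ‖creationFun f m i φ (i :: α)‖ ^ 2) :=
    Summable.of_nonneg_of_le (fun _ => sq_nonneg _) hle (hφ.mul_left _).summable
  have hs' := (hinj.hasSum_iff hsupp).1 hs.hasSum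
  refine ⟨hs'.summable, ?_⟩
  rw [hs'.tsum_eq, ← (hφ.mul_left (f.coeff [i])⁻¹).tsum_eq]
  exact hs.tsum_le_tsum hle (hφ.mul_left _).summable

/-- The weighted left creation operator `W_i` on the full Fock space, as a linear map. -/
def creationLin (f : PosRegFreeHol n H) (m : ℕ) (i : Fin n) : Fock n →ₗ[ℂ] Fock n where
  toFun φ := ⟨creationFun f m i φ, memℓp_gen (by
    simpa using (creationFun_hasSum f m i φ).1)⟩
  map_add' φ ψ := by
    ext β
    change creationFun f m i (fun α => φ α + ψ α) β =
      creationFun f m i φ β + creationFun f m i ψ β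
    rcases β with _ | ⟨j, α⟩
    · simp [creationFun]
    · by_cases h : j = i <;> simp [creationFun, h, mul_add]
  map_smul' c φ := by
    ext β
    rcases β with _ | ⟨j, α⟩
    · simp [creationFun]
    · by_cases h : j = i <;> simp [creationFun, h, mul_left_comm]

/-- The weighted left creation operator `W_i`, a bounded operator on the full Fock space. -/
def creation (f : PosRegFreeHol n H) (m : ℕ) (i : Fin n) : Fock n →L[ℂ] Fock n :=
  (creationLin f m i).mkContinuous (Real.sqrt (f.coeff [i])⁻¹) (by
    intro φ
    have h1 := lp.hasSum_norm (p := 2) (by norm_num) (creationLin f m i φ)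
    have h2 : HasSum (fun β => ‖creationFun f m i φ β‖ ^ 2) (‖creationLin f m i φ‖ ^ 2) := by
      simpa [creationLin] using h1
    have h3 : ‖creationLin f m i φ‖ ^ 2 ≤ (f.coeff [i])⁻¹ * ‖φ‖ ^ 2 := by
      rw [← h2.tsum_eq]
      exact (creationFun_hasSum f m i φ).2
    have h4 : (0 : ℝ) ≤ (f.coeff [i])⁻¹ := inv_nonneg.2 (f.coeff_nonneg _)
    apply le_of_sq_le_sq _ (by positivity)
    rw [mul_pow, Real.sq_sqrt h4]
    exact h3)

/-- `W_i e_α = (√b_α / √b_{g_i α}) e_{g_i α}`. -/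
theorem creation_basisVec (f : PosRegFreeHol n H) (m : ℕ) (i : Fin n) (α : Word n) :
    creation f m i (basisVec α) =
      ((Real.sqrt (bCoeff f m α) / Real.sqrt (bCoeff f m (i :: α)) : ℝ) : ℂ) •
        basisVec (i :: α) := by
  ext β
  have : creation f m i (basisVec α) β = creationFun f m i (basisVec α) β := rfl
  rw [this]
  rcases β with _ | ⟨j, β⟩
  · simp [creationFun, basisVec, lp.single_apply]
  · by_cases h : j = i
    · subst h
      by_cases h' : β = α
      · subst h'
        simp [creationFun, basisVec]
      · simp [creationFun, basisVec, lp.single_apply, h']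
    · simp [creationFun, basisVec, lp.single_apply, h]

/-- The vector `w^k = (1 / γ_k) ∑_{α ∈ Λ_k} √b_α e_α`. -/
def symVec (f : PosRegFreeHol n H) (m : ℕ) (k : Fin n →₀ ℕ) : Fock n :=
  ((gammaCoeff f m k)⁻¹ : ℂ) •
    ∑ α ∈ wordsOfType k, (Real.sqrt (bCoeff f m α) : ℂ) • basisVec α

/-- The symmetric weighted Fock space: the closed span of the vectors `w^k`. -/
def symFock (f : PosRegFreeHol n H) (m : ℕ) : Submodule ℂ (Fock n) :=
  (Submodule.span ℂ (Set.range (symVec f m))).topologicalClosure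

instance (f : PosRegFreeHol n H) (m : ℕ) : CompleteSpace (symFock f m) :=
  inferInstanceAs (CompleteSpace (Submodule.span ℂ (Set.range (symVec f m))).topologicalClosure)

/-- The operator `L_i`: the compression of `W_i` to the symmetric weighted Fock space. -/
def symShift (f : PosRegFreeHol n H) (m : ℕ) (i : Fin n) : symFock f m →L[ℂ] symFock f m :=
  (symFock f m).orthogonalProjectionOnto ∘L creation f m i ∘L (symFock f m).subtypeL

/-! ### The scalar domain contains a polydisc; uniqueness of power series on it -/

theorem evalWord_norm_sq_le {x : Fin n → ℂ} {q : ℝ} (hx : ∀ i, ‖x i‖ ^ 2 ≤ q)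
    (α : Word n) : ‖evalWord x α‖ ^ 2 ≤ q ^ α.length := by
  induction α with
  | nil => simp [evalWord]
  | cons i α ih =>
    have : evalWord x (i :: α) = x i * evalWord x α := by simp [evalWord]
    rw [this, norm_mul, mul_pow, List.length_cons, pow_succ' q]
    exact mul_le_mul (hx i) ih (sq_nonneg _) ((sq_nonneg _).trans (hx i))

theorem exists_summable [Nontrivial H] (f : PosRegFreeHol n H) :
    ∃ t : ℝ, 0 < t ∧ Summable (fun k : ℕ => (∑ v : Fin k → Fin n, f.coeff (List.ofFn v)) * t ^ k)
    := by
  obtain ⟨t, ht, htρ⟩ : ∃ t : ℝ, 0 < t ∧ (n : ℝ) * t ^ 2 < f.ρ := by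
    have hc : Tendsto (fun t : ℝ => (n : ℝ) * t ^ 2) (𝓝[>] 0) (𝓝 0) := by
      have : Continuous (fun t : ℝ => (n : ℝ) * t ^ 2) := by fun_prop
      simpa using (this.tendsto 0).mono_left nhdsWithin_le_nhds
    obtain ⟨t, h1, h2⟩ := ((hc.eventually_lt_const f.ρ_pos).and self_mem_nhdsWithin).exists
    exact ⟨t, h2, h1⟩
  refine ⟨t, ht, ?_⟩
  have hA : ∀ k : ℕ, 0 ≤ (∑ v : Fin k → Fin n, f.coeff (List.ofFn v)) * t ^ k := fun k =>
    mul_nonneg (Finset.sum_nonneg fun _ _ => f.coeff_nonneg _) (pow_nonneg ht.le _)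
  obtain ⟨Y, hY⟩ := f.converges (fun _ => (t : ℂ) • (1 : H →L[ℂ] H)) (by
    have h1 : ∀ i : Fin n, ((t : ℂ) • (1 : H →L[ℂ] H)) *
        ContinuousLinearMap.adjoint ((t : ℂ) • (1 : H →L[ℂ] H)) =
        ((t ^ 2 : ℝ) : ℂ) • (1 : H →L[ℂ] H) := by
      intro i
      have : ContinuousLinearMap.adjoint ((t : ℂ) • (1 : H →L[ℂ] H)) =
          (t : ℂ) • (1 : H →L[ℂ] H) := by
        rw [← ContinuousLinearMap.star_eq_adjoint, star_smul, star_one]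
        simp
      rw [this, smul_mul_smul_comm, mul_one]
      congr 1
      push_cast
      ring
    rw [Finset.sum_congr rfl (fun i _ => h1 i), Finset.sum_const, Finset.card_univ,
      Fintype.card_fin, ← Nat.cast_smul_eq_nsmul ℂ, smul_smul, norm_smul, norm_one, mul_one,
      norm_mul, Complex.norm_real, Real.norm_eq_abs, abs_of_nonneg (sq_nonneg t)]
    simpa using htρ)
  have hterm : ∀ N : ℕ, (∑ k ∈ Finset.range N, ∑ v : Fin k → Fin n,
      (f.coeff (List.ofFn v) : ℂ) • evalWord (fun _ => (t : ℂ) • (1 : H →L[ℂ] H))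
        (List.ofFn v)) =
      ((∑ k ∈ Finset.range N, (∑ v : Fin k → Fin n, f.coeff (List.ofFn v)) * t ^ k : ℝ) : ℂ) •
        (1 : H →L[ℂ] H) := by
    intro N
    rw [Complex.ofReal_sum, Finset.sum_smul]
    apply Finset.sum_congr rfl
    intro k _
    rw [Complex.ofReal_mul, Complex.ofReal_sum, Finset.sum_mul, Finset.sum_smul]
    apply Finset.sum_congr rfl
    intro v _
    have : evalWord (fun _ => (t : ℂ) • (1 : H →L[ℂ] H)) (List.ofFn v) =
        ((t : ℂ) ^ k) • (1 : H →L[ℂ] H) := by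
      have hr : (List.ofFn v).map (fun _ => (t : ℂ) • (1 : H →L[ℂ] H)) =
          List.replicate k ((t : ℂ) • (1 : H →L[ℂ] H)) := by
        rw [List.map_const', List.length_ofFn]
      rw [evalWord, hr, List.prod_replicate, smul_pow, one_pow]
    rw [this, smul_smul]
    push_cast
    rfl
  have hnorm := hY.norm
  simp only [hterm, norm_smul, norm_one, mul_one, Complex.norm_real, Real.norm_eq_abs] at hnorm
  obtain ⟨C, hC⟩ := hnorm.bddAbove_range
  exact summable_of_sum_range_le (c := C) hA fun N =>
    (le_abs_self _).trans (hC ⟨N, rfl⟩)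

theorem exists_polydisc [Nontrivial H] (f : PosRegFreeHol n H) :
    ∃ r : ℝ, 0 < r ∧ ∀ x : Fin n → ℂ, (∀ i, ‖x i‖ ≤ r) → x ∈ scalarDomain f := by
  obtain ⟨t, ht, hs⟩ := exists_summable f
  set A : ℕ → ℝ := fun k => ∑ v : Fin k → Fin n, f.coeff (List.ofFn v) with hAdef
  have hA : ∀ k, 0 ≤ A k := fun k => Finset.sum_nonneg fun _ _ => f.coeff_nonneg _
  have hA0 : A 0 = 0 := by simp [hAdef, f.coeff_nil]
  set C : ℝ := ∑' k, A k * t ^ k with hC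
  have hC0 : 0 ≤ C := tsum_nonneg fun k => mul_nonneg (hA k) (pow_nonneg ht.le _)
  set u : ℝ := 1 / (C + 2) with hu
  have hu0 : 0 < u := by positivity
  have hu1 : u ≤ 1 := by
    rw [hu, div_le_one (by linarith)]
    linarith
  have huC : u * C < 1 := by
    rw [hu, one_div, inv_mul_eq_div, div_lt_one (by linarith)]
    linarith
  have hle : ∀ k, A k * (u * t) ^ k ≤ u * (A k * t ^ k) := by
    intro k
    rcases k with _ | k
    · simp [hA0]
    · have h1 : u ^ (k + 1) ≤ u := by
        rw [pow_succ]
        exact mul_le_of_le_one_left hu0.le (pow_le_one₀ hu0.le hu1)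
      have h2 : 0 ≤ A (k + 1) * t ^ (k + 1) := mul_nonneg (hA _) (pow_nonneg ht.le _)
      rw [mul_pow]
      nlinarith
  have hs' : Summable (fun k => A k * (u * t) ^ k) :=
    Summable.of_nonneg_of_le (fun k => mul_nonneg (hA k) (by positivity)) hle (hs.mul_left u)
  have hlt : ∑' k, A k * (u * t) ^ k < 1 := by
    calc ∑' k, A k * (u * t) ^ k ≤ ∑' k, u * (A k * t ^ k) := hs'.tsum_le_tsum hle (hs.mul_left u)
      _ = u * C := by rw [tsum_mul_left]
      _ < 1 := huC
  refine ⟨Real.sqrt (u * t), Real.sqrt_pos.2 (by positivity), fun x hx => ?_⟩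
  have hx' : ∀ i, ‖x i‖ ^ 2 ≤ u * t := fun i => by
    have := pow_le_pow_left₀ (norm_nonneg _) (hx i) 2
    rwa [Real.sq_sqrt (by positivity)] at this
  have hbound : ∀ α : Word n,
      f.coeff α * ‖evalWord x α‖ ^ 2 ≤ f.coeff α * (u * t) ^ α.length := fun α =>
    mul_le_mul_of_nonneg_left (evalWord_norm_sq_le hx' α) (f.coeff_nonneg α)
  have hsig : HasSum (fun p : Σ k, Fin k → Fin n => f.coeff (List.ofFn p.2) * (u * t) ^ p.1)
      (∑' k, A k * (u * t) ^ k) := by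
    have hsum : Summable (fun p : Σ k, Fin k → Fin n =>
        f.coeff (List.ofFn p.2) * (u * t) ^ p.1) := by
      rw [summable_sigma_of_nonneg
        (fun p => mul_nonneg (f.coeff_nonneg _) (pow_nonneg (by positivity) _))]
      refine ⟨fun k => (hasSum_fintype _).summable, ?_⟩
      simpa only [tsum_fintype, ← Finset.sum_mul] using hs'
    have := hsum.hasSum
    rw [hsum.tsum_sigma] at this
    simpa only [tsum_fintype, ← Finset.sum_mul] using this
  have hword : HasSum (fun α : Word n => f.coeff α * (u * t) ^ α.length)
      (∑' k, A k * (u * t) ^ k) := by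
    rw [← (List.equivSigmaTuple (α := Fin n)).symm.hasSum_iff]
    convert hsig using 2 with p
    simp [List.equivSigmaTuple]
  have hsx : Summable (fun α : Word n => f.coeff α * ‖evalWord x α‖ ^ 2) :=
    Summable.of_nonneg_of_le (fun α => mul_nonneg (f.coeff_nonneg α) (sq_nonneg _)) hbound
      hword.summable
  refine ⟨hsx, ?_⟩
  calc _ ≤ _ := hsx.tsum_le_tsum hbound hword.summable
    _ = _ := hword.tsum_eq
    _ < 1 := hlt

/-- The monomial `λ^k = λ₁^{k₁} ⋯ λₙ^{kₙ}`. -/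
def monomialAt (x : Fin n → ℂ) (k : Fin n →₀ ℕ) : ℂ := ∏ i, x i ^ k i

theorem hasSum_by_degree (F : (Fin n →₀ ℕ) → ℂ) {a : ℂ} (h : HasSum F a) :
    HasSum (fun N => ∑ k ∈ Finset.univ.finsuppAntidiag N, F k) a := by
  let d : (Fin n →₀ ℕ) → ℕ := fun k => ∑ i, k i
  have h2 : HasSum (F ∘ Equiv.sigmaFiberEquiv d) a := (Equiv.sigmaFiberEquiv d).hasSum_iff.2 h
  refine h2.sigma fun N => ?_
  have e : ∀ k : Fin n →₀ ℕ, d k = N ↔ k ∈ Finset.univ.finsuppAntidiag N :=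
    fun k => by simp [d, Finset.mem_finsuppAntidiag]
  exact (Equiv.subtypeEquivRight e).hasSum_iff.2
    (Finset.hasSum (Finset.univ.finsuppAntidiag N) F)

theorem powerSeries_unique [Nontrivial H] (f : PosRegFreeHol n H) (c : (Fin n →₀ ℕ) → ℂ)
    (h : ∀ x ∈ scalarDomain f, HasSum (fun k => c k * monomialAt x k) 0) : c = 0 := by
  obtain ⟨r, hr, hD⟩ := exists_polydisc f
  have key : ∀ (N : ℕ) (x : Fin n → ℂ), (∀ i, ‖x i‖ ≤ r) →
      ∑ k ∈ Finset.univ.finsuppAntidiag N, c k * monomialAt x k = 0 := by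
    intro N x hx
    set P : ℕ → ℂ := fun N => ∑ k ∈ Finset.univ.finsuppAntidiag N, c k * monomialAt x k with hP
    have hs : ∀ s : ℂ, ‖s‖ ≤ 1 → HasSum (fun N => s ^ N * P N) 0 := by
      intro s hs
      have h1 := h (fun i => s * x i) (hD _ fun i => by
        rw [norm_mul]
        exact (mul_le_of_le_one_left (norm_nonneg _) hs).trans (hx i))
      convert hasSum_by_degree _ h1 using 2 with N
      rw [hP, Finset.mul_sum]
      apply Finset.sum_congr rfl
      intro k hk
      have hk' : ∑ i, k i = N := (Finset.mem_finsuppAntidiag.1 hk).1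
      simp only [monomialAt, mul_pow, Finset.prod_mul_distrib, Finset.prod_pow_eq_pow_sum, hk']
      ring
    have hps : HasFPowerSeriesAt (0 : ℂ → ℂ) (FormalMultilinearSeries.ofScalars ℂ P) 0 := by
      rw [hasFPowerSeriesAt_iff]
      filter_upwards [Metric.closedBall_mem_nhds (0 : ℂ) one_pos] with s hs'
      have := hs s (by simpa using hs')
      simpa [FormalMultilinearSeries.coeff_ofScalars] using this
    have := congrArg (fun p => FormalMultilinearSeries.coeff p N) hps.eq_zero
    simp only [FormalMultilinearSeries.coeff_ofScalars] at this
    exact this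
  funext k
  set N := ∑ i, k i with hN
  let Q : MvPolynomial (Fin n) ℂ :=
    ∑ k ∈ Finset.univ.finsuppAntidiag N, MvPolynomial.monomial k (c k)
  have hQ : Q = 0 := by
    apply MvPolynomial.funext_set (fun _ => Metric.closedBall (0 : ℂ) r)
    · intro i
      exact (infinite_of_mem_nhds (0 : ℂ) (Metric.closedBall_mem_nhds 0 hr))
    · intro x hx
      have := key N x fun i => by simpa using hx i (Set.mem_univ i)
      rw [map_zero, map_sum]
      simpa [MvPolynomial.eval_monomial, monomialAt, Finsupp.prod_fintype] using this
  have hcoeff := congrArg (MvPolynomial.coeff k) hQ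
  simp only [Q, MvPolynomial.coeff_sum, MvPolynomial.coeff_monomial, MvPolynomial.coeff_zero,
    Finset.sum_ite_eq'] at hcoeff
  rw [if_pos (by simp [Finset.mem_finsuppAntidiag, hN])] at hcoeff
  exact hcoeff

/-! ### The Hilbert space of functions on the scalar domain -/

/-- `c` are the coefficients of a power series representation
`φ(λ) = ∑_k c_k λ^k` on the scalar domain with `∑_k |c_k|² / γ_k < ∞`. -/
structure IsPowerSeriesRep (f : PosRegFreeHol n H) (m : ℕ) (φ : scalarDomain f → ℂ)
    (c : (Fin n →₀ ℕ) → ℂ) : Prop where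
  summable : Summable (fun k => ‖c k‖ ^ 2 / gammaCoeff f m k)
  hasSum : ∀ x : scalarDomain f, HasSum (fun k => c k * monomialAt (x : Fin n → ℂ) k) (φ x)

theorem memℓp_iff_summable (f : PosRegFreeHol n H) (m : ℕ) (c : (Fin n →₀ ℕ) → ℂ) :
    Memℓp (fun k => c k / (Real.sqrt (gammaCoeff f m k) : ℂ)) 2 ↔
      Summable (fun k => ‖c k‖ ^ 2 / gammaCoeff f m k) := by
  rw [memℓp_gen_iff (by norm_num)]
  apply iff_of_eq
  congr 1
  funext k
  simp [div_pow, Real.sq_sqrt (gammaCoeff_pos f m k).le]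

theorem IsPowerSeriesRep.add {f : PosRegFreeHol n H} {m : ℕ} {φ ψ : scalarDomain f → ℂ}
    {c d : (Fin n →₀ ℕ) → ℂ} (hc : IsPowerSeriesRep f m φ c) (hd : IsPowerSeriesRep f m ψ d) :
    IsPowerSeriesRep f m (φ + ψ) (c + d) where
  summable := by
    rw [← memℓp_iff_summable]
    have := ((memℓp_iff_summable f m c).2 hc.summable).add
      ((memℓp_iff_summable f m d).2 hd.summable)
    convert this using 1
    funext k
    simp [add_div]
  hasSum x := by
    simpa [add_mul] using (hc.hasSum x).add (hd.hasSum x)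

theorem IsPowerSeriesRep.smul {f : PosRegFreeHol n H} {m : ℕ} {φ : scalarDomain f → ℂ}
    {c : (Fin n →₀ ℕ) → ℂ} (a : ℂ) (hc : IsPowerSeriesRep f m φ c) :
    IsPowerSeriesRep f m (a • φ) (a • c) where
  summable := by
    simpa [mul_pow, mul_div_assoc] using hc.summable.mul_left (‖a‖ ^ 2)
  hasSum x := by
    simpa [mul_assoc] using (hc.hasSum x).mul_left a

theorem IsPowerSeriesRep.unique [Nontrivial H] {f : PosRegFreeHol n H} {m : ℕ}
    {φ : scalarDomain f → ℂ} {c d : (Fin n →₀ ℕ) → ℂ} (hc : IsPowerSeriesRep f m φ c)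
    (hd : IsPowerSeriesRep f m φ d) : c = d := by
  rw [← sub_eq_zero]
  apply powerSeries_unique f
  intro x hx
  simpa [sub_mul] using (hc.hasSum ⟨x, hx⟩).sub (hd.hasSum ⟨x, hx⟩)

/-- The functions on the scalar domain that admit such a power series representation. -/
def hardySubmodule (f : PosRegFreeHol n H) (m : ℕ) : Submodule ℂ (scalarDomain f → ℂ) where
  carrier := {φ | ∃ c, IsPowerSeriesRep f m φ c}
  add_mem' := fun ⟨_, hc⟩ ⟨_, hd⟩ => ⟨_, hc.add hd⟩
  zero_mem' := ⟨0, ⟨by simp, fun x => by simp⟩⟩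
  smul_mem' := fun a _ ⟨_, hc⟩ => ⟨_, hc.smul a⟩

/-- The space `H²` of the functions on the scalar domain that admit a power series representation
`φ(λ) = ∑_k c_k λ^k` with `∑_k |c_k|² / γ_k < ∞`. It is a type of its own, so that it carries the
Hilbert space norm and not the topology of pointwise convergence. -/
def HardySpace (f : PosRegFreeHol n H) (m : ℕ) : Type :=
  ↥(hardySubmodule f m)

namespace HardySpace

variable {f : PosRegFreeHol n H} {m : ℕ}

instance : CoeFun (HardySpace f m) (fun _ => scalarDomain f → ℂ) := ⟨Subtype.val⟩

instance instAddCommGroup : AddCommGroup (HardySpace f m) :=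
  inferInstanceAs (AddCommGroup ↥(hardySubmodule f m))

instance instModule : Module ℂ (HardySpace f m) :=
  inferInstanceAs (Module ℂ ↥(hardySubmodule f m))

theorem ext {φ ψ : HardySpace f m} (h : ∀ x, φ x = ψ x) : φ = ψ := Subtype.ext (funext h)

theorem add_apply (φ ψ : HardySpace f m) (x : scalarDomain f) : (φ + ψ) x = φ x + ψ x := rfl

theorem smul_apply (a : ℂ) (φ : HardySpace f m) (x : scalarDomain f) : (a • φ) x = a * φ x := rfl

/-- The power series coefficients `c_k` of an element of `H²` (they are unique). -/
def coef (φ : HardySpace f m) : (Fin n →₀ ℕ) → ℂ := φ.2.choose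

theorem coef_spec (φ : HardySpace f m) : IsPowerSeriesRep f m φ (coef φ) := φ.2.choose_spec

/-- The injective linear map `φ ↦ (c_k / √γ_k)_k` of `H²` into `ℓ²`. -/
def coefMap [Nontrivial H] (f : PosRegFreeHol n H) (m : ℕ) :
    HardySpace f m →ₗ[ℂ] lp (fun _ : Fin n →₀ ℕ => ℂ) 2 where
  toFun φ := ⟨fun k => coef φ k / (Real.sqrt (gammaCoeff f m k) : ℂ),
    (memℓp_iff_summable f m _).2 (coef_spec φ).summable⟩
  map_add' φ ψ := by
    have h : coef (φ + ψ) = coef φ + coef ψ :=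
      (coef_spec (φ + ψ)).unique ((coef_spec φ).add (coef_spec ψ))
    ext k
    change coef (φ + ψ) k / (Real.sqrt (gammaCoeff f m k) : ℂ) =
      coef φ k / (Real.sqrt (gammaCoeff f m k) : ℂ) +
        coef ψ k / (Real.sqrt (gammaCoeff f m k) : ℂ)
    rw [h, Pi.add_apply, add_div]
  map_smul' a φ := by
    have h : coef (a • φ) = a • coef φ := (coef_spec (a • φ)).unique ((coef_spec φ).smul a)
    ext k
    simp [h, mul_div_assoc]

theorem coefMap_injective [Nontrivial H] : Function.Injective (coefMap f m) := by
  intro φ ψ h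
  have hc : coef φ = coef ψ := by
    funext k
    have hk : coef φ k / (Real.sqrt (gammaCoeff f m k) : ℂ) =
        coef ψ k / (Real.sqrt (gammaCoeff f m k) : ℂ) :=
      congrFun (congrArg (fun z : lp (fun _ : Fin n →₀ ℕ => ℂ) 2 =>
        (z : (Fin n →₀ ℕ) → ℂ)) h) k
    have hpos : (Real.sqrt (gammaCoeff f m k) : ℂ) ≠ 0 := by
      exact_mod_cast (Real.sqrt_pos.2 (gammaCoeff_pos f m k)).ne'
    field_simp at hk
    exact hk
  apply ext
  intro x
  have h1 := (coef_spec φ).hasSum x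
  rw [hc] at h1
  exact h1.unique ((coef_spec ψ).hasSum x)

/-- The norm on `H²` is given by `‖φ‖² = ∑_k |c_k|² / γ_k`, see `norm_sq_eq`. -/
instance instNormedAddCommGroup [Nontrivial H] : NormedAddCommGroup (HardySpace f m) :=
  NormedAddCommGroup.induced _ _ (coefMap f m) coefMap_injective

instance instInnerProductSpace [Nontrivial H] : InnerProductSpace ℂ (HardySpace f m) where
  norm_smul_le a φ := by
    change ‖coefMap f m (a • φ)‖ ≤ ‖a‖ * ‖coefMap f m φ‖
    rw [map_smul, norm_smul]
  inner φ ψ := inner ℂ (coefMap f m φ) (coefMap f m ψ)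
  norm_sq_eq_re_inner φ := norm_sq_eq_re_inner (𝕜 := ℂ) (coefMap f m φ)
  conj_inner_symm φ ψ := inner_conj_symm (coefMap f m φ) (coefMap f m ψ)
  add_left φ ψ χ := by
    rw [map_add, inner_add_left]
  smul_left φ ψ a := by
    rw [map_smul, inner_smul_left]

theorem norm_sq_eq [Nontrivial H] (φ : HardySpace f m) :
    ‖φ‖ ^ 2 = ∑' k, ‖coef φ k‖ ^ 2 / gammaCoeff f m k := by
  have h1 := (lp.hasSum_norm (p := 2) (by norm_num) (coefMap f m φ)).tsum_eq
  have h2 : ‖φ‖ = ‖coefMap f m φ‖ := rfl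
  rw [h2]
  have h3 : ∀ k, ‖coefMap f m φ k‖ ^ (2 : ENNReal).toReal =
      ‖coef φ k‖ ^ 2 / gammaCoeff f m k := by
    intro k
    have : coefMap f m φ k = coef φ k / (Real.sqrt (gammaCoeff f m k) : ℂ) := rfl
    rw [this]
    simp [div_pow, Real.sq_sqrt (gammaCoeff_pos f m k).le]
  simp only [h3] at h1
  rw [h1]
  simp

end HardySpace

/-- The algebra `H^∞` of all multipliers of `H²`, as an algebra of operators on `H²`: the bounded
operators of multiplication by some function on the scalar domain. -/
def multiplierAlgebra [Nontrivial H] (f : PosRegFreeHol n H) (m : ℕ) :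
    Subalgebra ℂ (HardySpace f m →L[ℂ] HardySpace f m) where
  carrier := {T | ∃ g : scalarDomain f → ℂ, ∀ (ψ : HardySpace f m) (x : scalarDomain f),
    T ψ x = g x * ψ x}
  mul_mem' := by
    rintro S T ⟨g, hg⟩ ⟨h, hh⟩
    refine ⟨fun x => g x * h x, fun ψ x => ?_⟩
    have : (S * T) ψ = S (T ψ) := rfl
    rw [this, hg, hh, mul_assoc]
  add_mem' := by
    rintro S T ⟨g, hg⟩ ⟨h, hh⟩
    refine ⟨fun x => g x + h x, fun ψ x => ?_⟩
    have : (S + T) ψ x = S ψ x + T ψ x := rfl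
    rw [this, hg, hh, add_mul]
  algebraMap_mem' := by
    intro a
    exact ⟨fun _ => a, fun ψ x => rfl⟩

/-! ### Reflexive operator algebras and WOT-closed algebras -/

section Operators

variable {E : Type*} [NormedAddCommGroup E] [InnerProductSpace ℂ E]

/-- `Lat 𝓤`: the closed subspaces that are invariant under each operator in `𝓤`. -/
def Lat (U : Set (E →L[ℂ] E)) : Set (Submodule ℂ E) :=
  {M | IsClosed (M : Set E) ∧ ∀ A ∈ U, ∀ x ∈ M, A x ∈ M}

/-- `Alg 𝓢`: the bounded operators that leave each subspace in `𝓢` invariant. -/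
def Alg (S : Set (Submodule ℂ E)) : Set (E →L[ℂ] E) :=
  {A | ∀ M ∈ S, ∀ x ∈ M, A x ∈ M}

/-- An algebra `𝓤` of operators is reflexive if `𝓤 = Alg Lat 𝓤`. -/
def IsReflexive (U : Subalgebra ℂ (E →L[ℂ] E)) : Prop :=
  (U : Set (E →L[ℂ] E)) = Alg (Lat (U : Set (E →L[ℂ] E)))

/-- The weakly closed algebra generated by `S` and the identity: the smallest unital algebra of
operators that contains `S` and is closed in the weak operator topology. -/
def wotClosedAlgebra (S : Set (E →L[ℂ] E)) : Subalgebra ℂ (E →L[ℂ] E) :=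
  sInf {A | S ⊆ A ∧
    IsClosed ((ContinuousLinearMapWOT.ofCLM : (E →L[ℂ] E) → (E →WOT[ℂ] E)) '' (A : Set _))}

end Operators

end

end FockDomain

open FockDomain

namespace FockDomain

noncomputable section

/-! ### Summability of `∑ b_α |λ_α|²` on the scalar domain -/

/-! Everything rests on the vectors z_λ = ∑_α √b_α conj(λ_α) e_α, for λ in the scalar domain.
Expanding b_α over factorizations dominates ‖z_λ‖² = ∑ b_α |λ_α|² by a negative binomial series in ∑
a_α |λ_α|² < 1, so z_λ lies in the Fock space (`summable_bCoeff_mul_norm_sq`). Grouping words by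
type gives ∑_k γ_k |λ^k|² < ∞. Hence every square-summable coefficient sequence defines a function,
H² is complete with orthonormal basis √γ_k λ^k, and point evaluations are bounded.

In the symmetric Fock space the vectors √γ_k w^k form an orthonormal basis, and U sends w^k to λ^k.
Since λ_α depends only on the type of α, z_λ is itself symmetric and (Uφ)(λ) = ⟨φ, z_λ⟩
(`functionalRep_apply`). It is also an eigenvector of W_i^* with eigenvalue conj(λ_i), so the
compression L_i becomes multiplication by λ_i.

Reflexivity: the functions vanishing at a given point form a closed subspace invariant under all
multipliers. An operator preserving each of these subspaces is multiplication by its value on the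
constant function 1.

Weakly closed algebra: multipliers are cut out by weakly continuous equations, which gives one
inclusion. For the other, the Fejér means of a multiplier T are polynomials in the coordinate
multipliers. They are bounded in norm by ‖T‖ (`norm_le_of_fejer`), and their matrix entries converge
to those of T, so they converge to T weakly. Plain partial sums of the power series need not be
bounded in norm. The Fejér bound is proved by a discrete window argument instead of averaging over
rotations. -/

theorem hasSum_pi_prod {ι : Type*} {g : ι → ℝ} (hg : ∀ i, 0 ≤ g i) {s : ℝ} (hs : HasSum g s)
    (j : ℕ) : HasSum (fun v : Fin j → ι => ∏ i, g (v i)) (s ^ j) := by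
  induction j with
  | zero => simp
  | succ j ih =>
    have hG : ∀ v : Fin j → ι, 0 ≤ ∏ i, g (v i) := fun v =>
      Finset.prod_nonneg fun i _ => hg (v i)
    have hmul := HasSum.mul hs ih (Summable.mul_of_nonneg (f := g)
      (g := fun v : Fin j → ι => ∏ i, g (v i)) hs.summable ih.summable hg hG)
    rw [← (Fin.consEquiv (fun _ : Fin (j + 1) => ι)).hasSum_iff, pow_succ']
    have hcons : (fun v : Fin (j + 1) → ι => ∏ i, g (v i)) ∘ Fin.consEquiv (fun _ => ι) =
        fun p : ι × (Fin j → ι) => g p.1 * ∏ i, g (p.2 i) := by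
      ext p
      simp [Fin.consEquiv, Fin.prod_univ_succ]
    rw [hcons]
    exact hmul

/-- The lists of length j contribute s ^ j with s = ∑ g, up to the binomial factor. What remains is
the negative binomial series ∑_j C(j+m, m) s ^ j, convergent because s < 1. -/
theorem summable_list_prod {ι : Type*} {g : ι → ℝ} (hg : ∀ i, 0 ≤ g i) (hs : Summable g)
    (hlt : ∑' i, g i < 1) (m : ℕ) :
    Summable (fun l : List ι => (l.map g).prod * ((l.length + m).choose m : ℝ)) := by
  have h0 : 0 ≤ ∑' i, g i := tsum_nonneg hg
  rw [← (List.equivSigmaTuple (α := ι)).symm.summable_iff]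
  have hsig : Summable (fun p : Σ j, Fin j → ι =>
      (∏ i, g (p.2 i)) * ((p.1 + m).choose m : ℝ)) := by
    have hG : ∀ p : Σ j, Fin j → ι, 0 ≤ (∏ i, g (p.2 i)) * ((p.1 + m).choose m : ℝ) := fun p =>
      mul_nonneg (Finset.prod_nonneg fun i _ => hg (p.2 i)) (Nat.cast_nonneg _)
    rw [summable_sigma_of_nonneg hG]
    have hpi := fun j => hasSum_pi_prod hg hs.hasSum j
    refine ⟨fun j => Summable.mul_right ((j + m).choose m : ℝ) (hpi j).summable, ?_⟩
    have := summable_choose_mul_geometric_of_norm_lt_one m (r := ∑' i, g i)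
      (by rwa [Real.norm_eq_abs, abs_of_nonneg h0])
    refine this.congr fun j => ?_
    change _ = ∑' v : Fin j → ι, (∏ i, g (v i)) * ((j + m).choose m : ℝ)
    rw [tsum_mul_right, (hpi j).tsum_eq, mul_comm]
  convert hsig using 2 with p
  simp [List.equivSigmaTuple, List.map_ofFn, List.prod_ofFn]

theorem evalWord_flatten {n : ℕ} {R : Type*} [Monoid R] (x : Fin n → R) (l : List (Word n)) :
    evalWord x l.flatten = (l.map (evalWord x)).prod := by
  induction l with
  | nil => simp [evalWord]
  | cons α l ih =>
    rw [List.map_cons, List.prod_cons, ← ih]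
    simp [evalWord]

variable {n : ℕ} {H : Type*} [NormedAddCommGroup H] [InnerProductSpace ℂ H] [CompleteSpace H]

theorem prod_map_coeff_mul_norm_sq (f : PosRegFreeHol n H) (x : Fin n → ℂ) (l : List (Word n)) :
    (l.map fun γ => f.coeff γ * ‖evalWord x γ‖ ^ 2).prod =
      (l.map f.coeff).prod * ‖evalWord x l.flatten‖ ^ 2 := by
  rw [evalWord_flatten]
  induction l with
  | nil => simp
  | cons α l ih =>
    simp only [List.map_cons, List.prod_cons, ih, norm_mul]
    ring

/-- The concatenation of the pieces recovers the word, and their lengths recover the composition. -/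
theorem splitWrtComposition_injective {ι : Type*} : Function.Injective
    (fun p : Σ α : List ι, Composition α.length => p.1.splitWrtComposition p.2) := by
  rintro ⟨α, c⟩ ⟨β, d⟩ h
  have h1 : α.splitWrtComposition c = β.splitWrtComposition d := h
  obtain rfl : α = β := by
    rw [← List.flatten_splitWrtComposition α c, h1, List.flatten_splitWrtComposition]
  obtain rfl : c = d := by
    apply Composition.ext
    rw [← List.map_length_splitWrtComposition α c, h1, List.map_length_splitWrtComposition]
  rfl

/-- By multiplicativity of λ ↦ λ_α, expanding b_α turns the series into a sum over factorized words,
that is, over a subfamily of all lists of words. There `summable_list_prod` applies with g γ = a_γ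
|λ_γ|², whose sum is below 1 by definition of the domain. -/
theorem summable_bCoeff_mul_norm_sq (f : PosRegFreeHol n H) (m : ℕ) {x : Fin n → ℂ}
    (hx : x ∈ scalarDomain f) :
    Summable (fun α : Word n => bCoeff f m α * ‖evalWord x α‖ ^ 2) := by
  have hg : ∀ γ : Word n, 0 ≤ f.coeff γ * ‖evalWord x γ‖ ^ 2 := fun γ =>
    mul_nonneg (f.coeff_nonneg γ) (sq_nonneg _)
  have h1 := ((summable_list_prod hg hx.1 hx.2 m).comp_injective
    splitWrtComposition_injective).sigma
  refine Summable.of_nonneg_of_le (fun α => mul_nonneg (bCoeff_nonneg f m α) (sq_nonneg _))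
    (fun α => ?_) h1
  rw [tsum_fintype, bCoeff, Finset.sum_mul]
  refine Finset.sum_le_sum fun c _ => ?_
  simp only [Function.comp_apply, prod_map_coeff_mul_norm_sq, List.flatten_splitWrtComposition,
    List.length_splitWrtComposition]
  -- The larger binomial coefficient avoids truncated subtraction: Pascal's rule covers positive m,
  -- and for m = 0 both sides are 1.
  have hch : (c.length + m - 1).choose (m - 1) ≤ (c.length + m).choose m := by
    rcases m with _ | m
    · simp
    · rw [← add_assoc, Nat.choose_succ_succ]
      exact Nat.le_add_right _ _
  have hch' : ((c.length + m - 1).choose (m - 1) : ℝ) ≤ ((c.length + m).choose m : ℝ) := by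
    exact_mod_cast hch
  rw [mul_right_comm]
  exact mul_le_mul_of_nonneg_left hch' (mul_nonneg (prod_coeff_nonneg f _) (sq_nonneg _))

/-! ### Words and their types -/

/-- The multi-index counting the occurrences of the generators in a word. -/
def wordType (α : Word n) : Fin n →₀ ℕ := Multiset.toFinsupp (α : Multiset (Fin n))

theorem wordType_apply (α : Word n) (i : Fin n) : wordType α i = α.count i := by
  simp [wordType]

theorem mem_wordsOfType_iff (k : Fin n →₀ ℕ) (α : Word n) :
    α ∈ wordsOfType k ↔ wordType α = k := by
  simp [mem_wordsOfType, Finsupp.ext_iff, wordType_apply]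

theorem monomialAt_zero (x : Fin n → ℂ) : monomialAt x 0 = 1 := by
  simp [monomialAt]

theorem monomialAt_add (x : Fin n → ℂ) (k l : Fin n →₀ ℕ) :
    monomialAt x (k + l) = monomialAt x k * monomialAt x l := by
  simp [monomialAt, pow_add, Finset.prod_mul_distrib]

theorem evalWord_eq_monomialAt (x : Fin n → ℂ) (α : Word n) :
    evalWord x α = monomialAt x (wordType α) := by
  simp only [monomialAt, wordType_apply]
  exact Finset.prod_list_map_count α x |>.trans <| Finset.prod_subset (Finset.subset_univ _)
    fun i _ hi => by simp [List.count_eq_zero.2 (fun h => hi (List.mem_toFinset.2 h))]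

theorem evalWord_of_mem_wordsOfType (x : Fin n → ℂ) {k : Fin n →₀ ℕ} {α : Word n}
    (h : α ∈ wordsOfType k) : evalWord x α = monomialAt x k := by
  rw [evalWord_eq_monomialAt, (mem_wordsOfType_iff k α).1 h]

/-- The sets Λ_k are the fibres of `wordType`, hence a partition of the words into finite sets. -/
theorem hasSum_by_type {E : Type*} [NormedAddCommGroup E] (F : Word n → E) {a : E}
    (h : HasSum F a) : HasSum (fun k => ∑ α ∈ wordsOfType k, F α) a := by
  refine ((Equiv.sigmaFiberEquiv (wordType (n := n))).hasSum_iff.2 h).sigma fun k => ?_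
  exact (Equiv.subtypeEquivRight fun α => (mem_wordsOfType_iff k α).symm).hasSum_iff.2
    (Finset.hasSum (wordsOfType k) F)

theorem summable_gammaCoeff_mul_norm_sq (f : PosRegFreeHol n H) (m : ℕ) {x : Fin n → ℂ}
    (hx : x ∈ scalarDomain f) :
    Summable (fun k => gammaCoeff f m k * ‖monomialAt x k‖ ^ 2) := by
  refine (hasSum_by_type _ (summable_bCoeff_mul_norm_sq f m hx).hasSum).summable.congr fun k => ?_
  rw [gammaCoeff, Finset.sum_mul]
  exact Finset.sum_congr rfl fun α hα => by rw [evalWord_of_mem_wordsOfType x hα]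

end

end FockDomain

namespace FockDomain

noncomputable section

variable {n : ℕ} {H : Type*} [NormedAddCommGroup H] [InnerProductSpace ℂ H] [CompleteSpace H]

/-! ### The Hilbert space `H²` as a sequence space -/

/-- The vector `(√γ_k conj(λ^k))_k` of `ℓ²`, which represents the evaluation at `λ`. -/
def kernelSeq (f : PosRegFreeHol n H) (m : ℕ) (x : scalarDomain f) :
    lp (fun _ : Fin n →₀ ℕ => ℂ) 2 :=
  ⟨fun k => conj ((Real.sqrt (gammaCoeff f m k) : ℂ) * monomialAt (x : Fin n → ℂ) k),
    memℓp_gen (by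
      refine (summable_gammaCoeff_mul_norm_sq f m x.2).congr fun k => ?_
      simp [mul_pow, Real.sq_sqrt (gammaCoeff_pos f m k).le])⟩

theorem kernelSeq_apply (f : PosRegFreeHol n H) (m : ℕ) (x : scalarDomain f) (k : Fin n →₀ ℕ) :
    kernelSeq f m x k = conj ((Real.sqrt (gammaCoeff f m k) : ℂ) * monomialAt (x : Fin n → ℂ) k) :=
  rfl

theorem hasSum_inner_kernelSeq (f : PosRegFreeHol n H) (m : ℕ) (x : scalarDomain f)
    (z : lp (fun _ : Fin n →₀ ℕ => ℂ) 2) :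
    HasSum (fun k => z k * (Real.sqrt (gammaCoeff f m k) : ℂ) * monomialAt (x : Fin n → ℂ) k)
      (inner ℂ (kernelSeq f m x) z) := by
  have h := lp.hasSum_inner (𝕜 := ℂ) (kernelSeq f m x) z
  simpa only [RCLike.inner_apply, kernelSeq_apply, Complex.conj_conj, mul_assoc] using h

theorem sqrt_gammaCoeff_ne_zero (f : PosRegFreeHol n H) (m : ℕ) (k : Fin n →₀ ℕ) :
    (Real.sqrt (gammaCoeff f m k) : ℂ) ≠ 0 := by
  exact_mod_cast (Real.sqrt_pos.2 (gammaCoeff_pos f m k)).ne'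

namespace HardySpace

variable [Nontrivial H] {f : PosRegFreeHol n H} {m : ℕ}

theorem coefMap_apply (φ : HardySpace f m) (k : Fin n →₀ ℕ) :
    coefMap f m φ k = coef φ k / (Real.sqrt (gammaCoeff f m k) : ℂ) := rfl

/-- The scalar domain contains a polydisc, so a pointwise expansion alone determines the
coefficients; square summability of `c` need not be checked beforehand. -/
theorem coef_eq_of_hasSum (φ : HardySpace f m) (c : (Fin n →₀ ℕ) → ℂ)
    (h : ∀ x : scalarDomain f, HasSum (fun k => c k * monomialAt (x : Fin n → ℂ) k) (φ x)) :
    coef φ = c := by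
  rw [← sub_eq_zero]
  apply powerSeries_unique f
  intro x hx
  simpa [sub_mul] using ((coef_spec φ).hasSum ⟨x, hx⟩).sub (h ⟨x, hx⟩)

/-- Pairing an ℓ² sequence with `kernelSeq` is an absolutely convergent series at each point of the
domain, so it defines a function in H² with the prescribed coefficients. Completeness of H² follows
from this. -/
theorem coefMap_surjective : Function.Surjective (coefMap f m) := by
  intro z
  let c : (Fin n →₀ ℕ) → ℂ := fun k => z k * (Real.sqrt (gammaCoeff f m k) : ℂ)
  have hz : (fun k => c k / (Real.sqrt (gammaCoeff f m k) : ℂ)) = z := by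
    funext k
    exact mul_div_cancel_right₀ _ (sqrt_gammaCoeff_ne_zero f m k)
  have hrep : IsPowerSeriesRep f m (fun x => inner ℂ (kernelSeq f m x) z) c :=
    ⟨(memℓp_iff_summable f m c).1 (by rw [hz]; exact z.2), fun x => hasSum_inner_kernelSeq f m x z⟩
  let φ : HardySpace f m := ⟨_, c, hrep⟩
  refine ⟨φ, ?_⟩
  ext k
  rw [coefMap_apply, coef_eq_of_hasSum φ c hrep.hasSum]
  exact congrFun hz k

variable (f m) in
/-- The unitary operator `φ ↦ (c_k / √γ_k)_k` from `H²` onto `ℓ²`. -/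
def coefEquiv : HardySpace f m ≃ₗᵢ[ℂ] lp (fun _ : Fin n →₀ ℕ => ℂ) 2 where
  toLinearEquiv := LinearEquiv.ofBijective (coefMap f m) ⟨coefMap_injective, coefMap_surjective⟩
  norm_map' _ := rfl

theorem coefEquiv_apply (φ : HardySpace f m) (k : Fin n →₀ ℕ) :
    coefEquiv f m φ k = coef φ k / (Real.sqrt (gammaCoeff f m k) : ℂ) := rfl

instance instCompleteSpace : CompleteSpace (HardySpace f m) :=
  (coefEquiv f m).toIsometryEquiv.completeSpace

/-- The evaluation at a point of the scalar domain, a bounded linear functional on `H²`. -/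
def evalCLM (x : scalarDomain f) : HardySpace f m →L[ℂ] ℂ :=
  innerSL ℂ (kernelSeq f m x) ∘L
    ((coefEquiv f m).toContinuousLinearEquiv : HardySpace f m →L[ℂ] _)

theorem evalCLM_apply (x : scalarDomain f) (φ : HardySpace f m) : evalCLM x φ = φ x := by
  have h : evalCLM x φ = inner ℂ (kernelSeq f m x) (coefEquiv f m φ) := rfl
  rw [h]
  refine (hasSum_inner_kernelSeq f m x _).unique ?_
  simp only [coefEquiv_apply, div_mul_cancel₀ _ (sqrt_gammaCoeff_ne_zero f m _)]
  exact (coef_spec φ).hasSum x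

variable (f m) in
/-- The orthonormal basis `√γ_k λ^k` of `H²`. -/
def monomialBasis : HilbertBasis (Fin n →₀ ℕ) ℂ (HardySpace f m) :=
  HilbertBasis.ofRepr (coefEquiv f m)

theorem monomialBasis_apply (k : Fin n →₀ ℕ) (x : scalarDomain f) :
    monomialBasis f m k x =
      (Real.sqrt (gammaCoeff f m k) : ℂ) * monomialAt (x : Fin n → ℂ) k := by
  have h : evalCLM x (monomialBasis f m k) =
      inner ℂ (kernelSeq f m x) (coefEquiv f m (monomialBasis f m k)) := rfl
  have h2 : coefEquiv f m (monomialBasis f m k) = lp.single 2 k (1 : ℂ) :=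
    (monomialBasis f m).repr_self k
  rw [← evalCLM_apply, h, h2, lp.inner_single_right]
  simp [kernelSeq_apply]

theorem inner_monomialBasis (k : Fin n →₀ ℕ) (φ : HardySpace f m) :
    inner ℂ (monomialBasis f m k) φ = coef φ k / (Real.sqrt (gammaCoeff f m k) : ℂ) := by
  rw [← HilbertBasis.repr_apply_apply]
  rfl

end HardySpace

/-! ### The symmetric weighted Fock space -/

/-- The vector `z_λ = ∑_α √b_α conj(λ_α) e_α` of the full Fock space. -/
def fockKernel (f : PosRegFreeHol n H) (m : ℕ) (x : scalarDomain f) : Fock n :=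
  ⟨fun α => conj ((Real.sqrt (bCoeff f m α) : ℂ) * evalWord (x : Fin n → ℂ) α),
    memℓp_gen (by
      refine (summable_bCoeff_mul_norm_sq f m x.2).congr fun α => ?_
      simp [mul_pow, Real.sq_sqrt (bCoeff_nonneg f m α)])⟩

theorem fockKernel_apply (f : PosRegFreeHol n H) (m : ℕ) (x : scalarDomain f) (α : Word n) :
    fockKernel f m x α =
      conj ((Real.sqrt (bCoeff f m α) : ℂ) * evalWord (x : Fin n → ℂ) α) := rfl

theorem hasSum_inner_fockKernel (f : PosRegFreeHol n H) (m : ℕ) (x : scalarDomain f)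
    (φ : Fock n) :
    HasSum (fun α => φ α * ((Real.sqrt (bCoeff f m α) : ℂ) * evalWord (x : Fin n → ℂ) α))
      (inner ℂ (fockKernel f m x) φ) := by
  have h := lp.hasSum_inner (𝕜 := ℂ) (fockKernel f m x) φ
  simpa only [RCLike.inner_apply, fockKernel_apply, Complex.conj_conj] using h

theorem inner_symVec (f : PosRegFreeHol n H) (m : ℕ) (k : Fin n →₀ ℕ) (φ : Fock n) :
    inner ℂ (symVec f m k) φ =
      ((gammaCoeff f m k)⁻¹ : ℂ) * ∑ α ∈ wordsOfType k, (Real.sqrt (bCoeff f m α) : ℂ) * φ α := by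
  rw [symVec, inner_smul_left, sum_inner]
  simp only [inner_smul_left, basisVec, lp.inner_single_left]
  simp

theorem symVec_apply (f : PosRegFreeHol n H) (m : ℕ) (k : Fin n →₀ ℕ) (α : Word n) :
    symVec f m k α = if wordType α = k then
      ((gammaCoeff f m k)⁻¹ : ℂ) * (Real.sqrt (bCoeff f m α) : ℂ) else 0 := by
  have h : inner ℂ (basisVec α) (symVec f m k) = symVec f m k α := by
    rw [basisVec, lp.inner_single_left]
    simp
  have h2 := inner_symVec f m k (basisVec α)
  rw [← h, ← inner_conj_symm, h2]
  simp only [basisVec, lp.single_apply, ← mem_wordsOfType_iff]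
  by_cases hα : α ∈ wordsOfType k
  · simp [hα, Pi.single_apply]
  · simp [hα, Pi.single_apply]

theorem sum_sqrt_bCoeff_mul_self (f : PosRegFreeHol n H) (m : ℕ) (k : Fin n →₀ ℕ) :
    ∑ α ∈ wordsOfType k, (Real.sqrt (bCoeff f m α) : ℂ) * (Real.sqrt (bCoeff f m α) : ℂ) =
      (gammaCoeff f m k : ℂ) := by
  rw [gammaCoeff, Complex.ofReal_sum]
  refine Finset.sum_congr rfl fun α _ => ?_
  rw [← Complex.ofReal_mul, Real.mul_self_sqrt (bCoeff_nonneg f m α)]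

theorem gammaCoeff_ne_zero (f : PosRegFreeHol n H) (m : ℕ) (k : Fin n →₀ ℕ) :
    (gammaCoeff f m k : ℂ) ≠ 0 := by
  exact_mod_cast (gammaCoeff_pos f m k).ne'

theorem inner_symVec_symVec (f : PosRegFreeHol n H) (m : ℕ) (k l : Fin n →₀ ℕ) :
    inner ℂ (symVec f m k) (symVec f m l) = if k = l then ((gammaCoeff f m k)⁻¹ : ℂ) else 0 := by
  rw [inner_symVec]
  have h : ∀ α ∈ wordsOfType k, (Real.sqrt (bCoeff f m α) : ℂ) * symVec f m l α =
      if k = l then ((gammaCoeff f m k)⁻¹ : ℂ) *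
        ((Real.sqrt (bCoeff f m α) : ℂ) * (Real.sqrt (bCoeff f m α) : ℂ)) else 0 := by
    intro α hα
    rw [symVec_apply, (mem_wordsOfType_iff k α).1 hα]
    split_ifs with hkl
    · subst hkl
      ring
    · simp
  rw [Finset.sum_congr rfl h]
  split_ifs
  · rw [← Finset.mul_sum, sum_sqrt_bCoeff_mul_self, inv_mul_cancel₀ (gammaCoeff_ne_zero f m k),
      mul_one]
  · simp

theorem symVec_mem_symFock (f : PosRegFreeHol n H) (m : ℕ) (k : Fin n →₀ ℕ) :
    symVec f m k ∈ symFock f m :=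
  Submodule.le_topologicalClosure _ (Submodule.subset_span ⟨k, rfl⟩)

theorem mem_orthogonal_symFock_iff (f : PosRegFreeHol n H) (m : ℕ) (φ : Fock n) :
    φ ∈ (symFock f m)ᗮ ↔ ∀ k, inner ℂ (symVec f m k) φ = 0 := by
  rw [symFock, Submodule.orthogonal_closure]
  refine ⟨fun h k => h _ (Submodule.subset_span ⟨k, rfl⟩), fun h => ?_⟩
  rw [Submodule.mem_orthogonal]
  intro u hu
  induction hu using Submodule.span_induction with
  | mem u hu =>
    obtain ⟨k, rfl⟩ := hu
    exact h k
  | zero => simp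
  | add u v _ _ hu hv => rw [inner_add_left, hu, hv, add_zero]
  | smul a u _ hu => rw [inner_smul_left, hu, mul_zero]

/-- It suffices to test against φ orthogonal to all w^k. On Λ_k the factor λ_α is constantly λ^k, so
the words of type k contribute λ^k γ_k ⟨φ, w^k⟩ = 0 to ⟨φ, z_λ⟩. -/
theorem fockKernel_mem_symFock (f : PosRegFreeHol n H) (m : ℕ) (x : scalarDomain f) :
    fockKernel f m x ∈ symFock f m := by
  rw [← (symFock f m).orthogonal_orthogonal, Submodule.mem_orthogonal']
  intro φ hφ
  rw [mem_orthogonal_symFock_iff] at hφ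
  refine (hasSum_by_type _ (hasSum_inner_fockKernel f m x φ)).unique ?_
  convert hasSum_zero with k
  have h := hφ k
  rw [inner_symVec, mul_eq_zero, or_iff_right (inv_ne_zero (gammaCoeff_ne_zero f m k))] at h
  rw [← zero_mul (monomialAt (x : Fin n → ℂ) k), ← h, Finset.sum_mul]
  refine Finset.sum_congr rfl fun α hα => ?_
  rw [evalWord_of_mem_wordsOfType _ hα]
  ring

/-- The unit vectors `√γ_k w^k` of the symmetric weighted Fock space. -/
def symUnitVec (f : PosRegFreeHol n H) (m : ℕ) (k : Fin n →₀ ℕ) : symFock f m :=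
  ⟨(Real.sqrt (gammaCoeff f m k) : ℂ) • symVec f m k,
    Submodule.smul_mem _ _ (symVec_mem_symFock f m k)⟩

theorem orthonormal_symUnitVec (f : PosRegFreeHol n H) (m : ℕ) :
    Orthonormal ℂ (symUnitVec f m) := by
  classical
  rw [orthonormal_iff_ite]
  intro k l
  rw [Submodule.coe_inner]
  simp only [symUnitVec, inner_smul_left, inner_smul_right, inner_symVec_symVec]
  split_ifs with hkl
  · subst hkl
    rw [← mul_assoc, Complex.conj_ofReal, ← Complex.ofReal_mul,
      Real.mul_self_sqrt (gammaCoeff_pos f m k).le, mul_inv_cancel₀ (gammaCoeff_ne_zero f m k)]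
  · simp

theorem orthogonal_span_symUnitVec (f : PosRegFreeHol n H) (m : ℕ) :
    (Submodule.span ℂ (Set.range (symUnitVec f m)))ᗮ = ⊥ := by
  rw [Submodule.eq_bot_iff]
  intro φ hφ
  have h : (φ : Fock n) ∈ (symFock f m)ᗮ := by
    rw [mem_orthogonal_symFock_iff]
    intro k
    have h1 : inner ℂ (symUnitVec f m k) φ = 0 := hφ _ (Submodule.subset_span ⟨k, rfl⟩)
    rw [Submodule.coe_inner, symUnitVec, inner_smul_left, mul_eq_zero] at h1
    refine h1.resolve_left ?_
    rw [Complex.conj_ofReal]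
    exact sqrt_gammaCoeff_ne_zero f m k
  have h0 : inner ℂ (φ : Fock n) (φ : Fock n) = 0 := h _ φ.2
  exact Subtype.ext (inner_self_eq_zero.1 h0)

/-- The orthonormal basis `√γ_k w^k` of the symmetric weighted Fock space. -/
def symBasis (f : PosRegFreeHol n H) (m : ℕ) : HilbertBasis (Fin n →₀ ℕ) ℂ (symFock f m) :=
  HilbertBasis.mkOfOrthogonalEqBot (orthonormal_symUnitVec f m) (orthogonal_span_symUnitVec f m)

theorem symBasis_apply (f : PosRegFreeHol n H) (m : ℕ) (k : Fin n →₀ ℕ) :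
    symBasis f m k = symUnitVec f m k := by
  rw [symBasis, HilbertBasis.coe_mkOfOrthogonalEqBot]

/-- This is the eigenvector equation W_i^* z_λ = conj(λ_i) z_λ, tested against φ. Only words
beginning with g_i contribute, and the weight √b_α / √b_{g_i α} of W_i cancels the coefficient
√b_{g_i α} of z_λ down to √b_α. -/
theorem inner_fockKernel_creation (f : PosRegFreeHol n H) (m : ℕ) (i : Fin n) (φ : Fock n) (x : scalarDomain f) :
    inner ℂ (fockKernel f m x) (creation f m i φ) =
      (x : Fin n → ℂ) i * inner ℂ (fockKernel f m x) φ := by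
  have h := hasSum_inner_fockKernel f m x (creation f m i φ)
  have hinj : Function.Injective (fun α : Word n => i :: α) := fun _ _ h => (List.cons.inj h).2
  have happ : ∀ β, creation f m i φ β = creationFun f m i φ β := fun _ => rfl
  rw [← hinj.hasSum_iff] at h
  · refine h.unique ?_
    have hmul := (hasSum_inner_fockKernel f m x φ).mul_left ((x : Fin n → ℂ) i)
    refine (congrArg (fun F => HasSum F _) (funext fun α => ?_)).mp hmul
    have hb : (Real.sqrt (bCoeff f m (i :: α)) : ℂ) ≠ 0 := by
      exact_mod_cast (Real.sqrt_pos.2 (bCoeff_pos f m _)).ne'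
    have hev : evalWord (x : Fin n → ℂ) (i :: α) =
        (x : Fin n → ℂ) i * evalWord (x : Fin n → ℂ) α := by simp [evalWord]
    simp only [Function.comp_apply, happ, hev, creationFun, if_true, Complex.ofReal_div]
    field_simp
  · intro β hβ
    rw [happ]
    rcases β with _ | ⟨j, α⟩
    · simp [creationFun]
    · have : j ≠ i := by
        rintro rfl
        exact hβ ⟨α, rfl⟩
      simp [creationFun, this]

/-! ### The functional representation of the symmetric weighted Fock space -/

section FunctionalRepresentation

variable [Nontrivial H] (f : PosRegFreeHol n H) (m : ℕ)

/-- The unitary operator from the symmetric weighted Fock space onto `H²` that maps `w^k` to the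
monomial `λ^k`. -/
def functionalRep : symFock f m ≃ₗᵢ[ℂ] HardySpace f m :=
  (symBasis f m).repr.trans (HardySpace.monomialBasis f m).repr.symm

theorem functionalRep_symUnitVec (k : Fin n →₀ ℕ) :
    functionalRep f m (symUnitVec f m k) = HardySpace.monomialBasis f m k := by
  classical
  rw [functionalRep, LinearIsometryEquiv.trans_apply, ← symBasis_apply, HilbertBasis.repr_self,
    HilbertBasis.repr_symm_single]

/-- Both sides are bounded linear functionals of φ, so it is enough to compare them on the basis
√γ_k w^k, where both equal √γ_k λ^k. -/
theorem functionalRep_apply (φ : symFock f m) (x : scalarDomain f) :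
    functionalRep f m φ x = inner ℂ (fockKernel f m x) (φ : Fock n) := by
  have h : HardySpace.evalCLM x ∘L
      ((functionalRep f m).toContinuousLinearEquiv : symFock f m →L[ℂ] HardySpace f m) =
      innerSL ℂ (fockKernel f m x) ∘L (symFock f m).subtypeL := by
    refine ContinuousLinearMap.ext_on (s := Set.range (symBasis f m)) ?_ ?_
    · exact Submodule.dense_iff_topologicalClosure_eq_top.2 (symBasis f m).dense_span
    · rintro _ ⟨k, rfl⟩
      rw [symBasis_apply]
      change HardySpace.evalCLM x (functionalRep f m (symUnitVec f m k)) =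
        inner ℂ (fockKernel f m x) ((Real.sqrt (gammaCoeff f m k) : ℂ) • symVec f m k)
      rw [functionalRep_symUnitVec, HardySpace.evalCLM_apply, HardySpace.monomialBasis_apply,
        inner_smul_right, ← inner_conj_symm, inner_symVec]
      congr 1
      have hsum : ∑ α ∈ wordsOfType k, (Real.sqrt (bCoeff f m α) : ℂ) * fockKernel f m x α =
          gammaCoeff f m k * conj (monomialAt (x : Fin n → ℂ) k) := by
        rw [← sum_sqrt_bCoeff_mul_self, Finset.sum_mul]
        refine Finset.sum_congr rfl fun α hα => ?_
        rw [fockKernel_apply, evalWord_of_mem_wordsOfType _ hα, map_mul, Complex.conj_ofReal,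
          mul_assoc]
      rw [hsum, inv_mul_cancel_left₀ (gammaCoeff_ne_zero f m k), Complex.conj_conj]
  rw [← HardySpace.evalCLM_apply]
  exact congrArg (fun F : symFock f m →L[ℂ] ℂ => F φ) h

theorem hasSum_functionalRep (φ : symFock f m) (x : scalarDomain f) :
    HasSum (fun α : Word n => (φ : Fock n) α *
      ((Real.sqrt (bCoeff f m α) : ℂ) * evalWord (x : Fin n → ℂ) α)) (functionalRep f m φ x) := by
  rw [functionalRep_apply]
  exact hasSum_inner_fockKernel f m x φ

theorem functionalRep_symShift (i : Fin n) (φ : symFock f m) (x : scalarDomain f) :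
    functionalRep f m (symShift f m i φ) x = (x : Fin n → ℂ) i * functionalRep f m φ x := by
  -- The projection in L_i disappears because z_λ already lies in the symmetric Fock space.
  have h : inner ℂ (fockKernel f m x) ((symShift f m i φ : symFock f m) : Fock n) =
      inner ℂ (fockKernel f m x) (creation f m i φ) :=
    Submodule.inner_orthogonalProjectionOnto_eq_of_mem_left
      (⟨fockKernel f m x, fockKernel_mem_symFock f m x⟩ : symFock f m) (creation f m i φ)
  rw [functionalRep_apply, functionalRep_apply, h, inner_fockKernel_creation]

end FunctionalRepresentation

end

end FockDomain

namespace FockDomain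

noncomputable section

/-! ### Fejér means of a bounded operator on a graded Hilbert space -/

section Fejer

variable {ι E : Type*} [NormedAddCommGroup E] [InnerProductSpace ℂ E]

/-- Uniformly bounded functionals are equicontinuous, so the set where they converge to `G` is
closed. -/
theorem tendsto_of_tendsto_on_dense {F : ℕ → E →L[ℂ] ℂ} {G : E →L[ℂ] ℂ} {C : ℝ}
    (hC : ∀ N, ‖F N‖ ≤ C) {s : Set E} (hs : Dense (Submodule.span ℂ s : Set E))
    (h : ∀ x ∈ s, Tendsto (fun N => F N x) atTop (𝓝 (G x))) (x : E) :
    Tendsto (fun N => F N x) atTop (𝓝 (G x)) := by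
  have hF : Equicontinuous ((↑) ∘ F) :=
    have htfae : Equicontinuous ((↑) ∘ F) ↔ ∃ C, ∀ N, ‖F N‖ ≤ C :=
      (NormedSpace.equicontinuous_TFAE F).out 1 5
    htfae.2 ⟨C, hC⟩
  have hcl : IsClosed {x | Tendsto (fun N => F N x) atTop (𝓝 (G x))} :=
    hF.isClosed_setOfPred_tendsto G.continuous
  refine hcl.closure_subset_iff.2 (fun y hy => ?_) (hs x)
  rw [Set.mem_ofPred_eq]
  induction hy using Submodule.span_induction with
  | mem y hy => exact h y hy
  | zero => simp
  | add y z _ _ hy hz => simpa using hy.add hz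
  | smul a y _ hy => simpa using hy.const_mul a

/-- For a norm-bounded sequence, convergence of matrix entries implies weak operator convergence:
the density argument is applied first in u with v a basis vector, then in v. -/
theorem tendsto_inner_of_tendsto_basis [CompleteSpace E] (b : HilbertBasis ι ℂ E)
    {S : ℕ → E →L[ℂ] E} {T : E →L[ℂ] E} {C : ℝ} (hC : ∀ N, ‖S N‖ ≤ C)
    (h : ∀ k l, Tendsto (fun N => inner ℂ (b l) (S N (b k))) atTop (𝓝 (inner ℂ (b l) (T (b k)))))
    (u v : E) : Tendsto (fun N => inner ℂ v (S N u)) atTop (𝓝 (inner ℂ v (T u))) := by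
  have hd : Dense (Submodule.span ℂ (Set.range b) : Set E) :=
    Submodule.dense_iff_topologicalClosure_eq_top.2 b.dense_span
  have h1 : ∀ l u, Tendsto (fun N => inner ℂ (b l) (S N u)) atTop (𝓝 (inner ℂ (b l) (T u))) := by
    intro l
    refine tendsto_of_tendsto_on_dense (F := fun N => innerSL ℂ (b l) ∘L S N)
      (G := innerSL ℂ (b l) ∘L T) (C := C) (fun N => ?_) hd ?_
    · refine (ContinuousLinearMap.opNorm_comp_le _ _).trans ?_
      rw [innerSL_apply_norm, b.orthonormal.1 l, one_mul]
      exact hC N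
    · rintro _ ⟨k, rfl⟩
      exact h k l
  have h2 : Tendsto (fun N => inner ℂ (S N u) v) atTop (𝓝 (inner ℂ (T u) v)) := by
    refine tendsto_of_tendsto_on_dense (F := fun N => innerSL ℂ (S N u)) (G := innerSL ℂ (T u))
      (C := C * ‖u‖) (fun N => ?_) hd ?_ v
    · rw [innerSL_apply_norm]
      exact (S N).le_of_opNorm_le (hC N) u
    · rintro _ ⟨l, rfl⟩
      have := (Complex.continuous_conj.tendsto _).comp (h1 l u)
      simpa only [Function.comp_def, inner_conj_symm, innerSL_apply_apply] using this
  have := (Complex.continuous_conj.tendsto _).comp h2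
  simpa only [Function.comp_def, inner_conj_symm] using this

/-- The part of the vector `∑ a_k v_k` whose degrees lie in the window `(r - N, r]`. -/
def windowPart (v : ι → E) (d : ι → ℕ) (N : ℕ) (s : Finset ι) (a : ι → ℂ) (r : ℕ) : E :=
  ∑ k ∈ s, (if r ∈ Finset.Ico (d k) (d k + N) then a k else 0) • v k

theorem norm_sq_sum_orthonormal {v : ι → E} (hv : Orthonormal ℂ v) (s : Finset ι) (a : ι → ℂ) :
    ‖∑ k ∈ s, a k • v k‖ ^ 2 = ∑ k ∈ s, ‖a k‖ ^ 2 := by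
  have h := hv.inner_sum a a s
  rw [inner_self_eq_norm_sq_to_K] at h
  simp only [RCLike.conj_mul] at h
  exact_mod_cast h

/-- Each degree lies in exactly N of the windows, and `R` contains all of them. -/
theorem sum_norm_sq_windowPart {v : ι → E} (hv : Orthonormal ℂ v) (d : ι → ℕ) (N : ℕ)
    (s : Finset ι) (a : ι → ℂ) {R : Finset ℕ} (hR : ∀ k ∈ s, Finset.Ico (d k) (d k + N) ⊆ R) :
    ∑ r ∈ R, ‖windowPart v d N s a r‖ ^ 2 = N * ‖∑ k ∈ s, a k • v k‖ ^ 2 := by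
  simp only [windowPart, norm_sq_sum_orthonormal hv]
  rw [Finset.sum_comm, Finset.mul_sum]
  refine Finset.sum_congr rfl fun k hk => ?_
  have : ∀ r, ‖(if r ∈ Finset.Ico (d k) (d k + N) then a k else 0)‖ ^ 2 =
      if r ∈ Finset.Ico (d k) (d k + N) then ‖a k‖ ^ 2 else 0 := by
    intro r
    split_ifs <;> simp
  simp only [this]
  rw [← Finset.sum_filter, Finset.filter_mem_eq_inter, Finset.inter_eq_right.2 (hR k hk),
    Finset.sum_const, Nat.card_Ico, nsmul_eq_mul, Nat.add_sub_cancel_left]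

/-- The Fejér weight of an entry counts the windows containing both of its degrees. Thus the Schur
multiplier is an average of the compressions of T to the windows. -/
theorem sum_inner_windowPart (v : ι → E) (d : ι → ℕ) (N : ℕ) (s : Finset ι) (a c : ι → ℂ)
    {S T : E →L[ℂ] E}
    (h : ∀ k l, (N : ℂ) * inner ℂ (v l) (S (v k)) =
      ((Finset.Ico (d l) (d l + N) ∩ Finset.Ico (d k) (d k + N)).card : ℂ) *
        inner ℂ (v l) (T (v k)))
    {R : Finset ℕ} (hR : ∀ k ∈ s, Finset.Ico (d k) (d k + N) ⊆ R) :
    (N : ℂ) * inner ℂ (∑ l ∈ s, c l • v l) (S (∑ k ∈ s, a k • v k)) =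
      ∑ r ∈ R, inner ℂ (windowPart v d N s c r) (T (windowPart v d N s a r)) := by
  simp only [windowPart, map_sum, map_smul, sum_inner, inner_sum, inner_smul_left,
    inner_smul_right, Finset.mul_sum]
  rw [Finset.sum_comm' (t' := s) (s' := fun _ => R) (by simp [and_comm])]
  refine Finset.sum_congr rfl fun k _ => ?_
  rw [Finset.sum_comm' (t' := s) (s' := fun _ => R) (by simp [and_comm])]
  refine Finset.sum_congr rfl fun l hl => ?_
  have hr : ∀ r, (if r ∈ Finset.Ico (d k) (d k + N) then a k else 0) *
      (conj (if r ∈ Finset.Ico (d l) (d l + N) then c l else 0) * inner ℂ (v l) (T (v k))) =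
      if r ∈ Finset.Ico (d l) (d l + N) ∩ Finset.Ico (d k) (d k + N) then
        a k * (conj (c l) * inner ℂ (v l) (T (v k))) else 0 := by
    intro r
    by_cases h1 : r ∈ Finset.Ico (d l) (d l + N) <;>
      by_cases h2 : r ∈ Finset.Ico (d k) (d k + N) <;> simp [h1, h2, -Finset.mem_Ico]
  have hsub : Finset.Ico (d l) (d l + N) ∩ Finset.Ico (d k) (d k + N) ⊆ R :=
    Finset.inter_subset_left.trans (hR l hl)
  simp only [hr]
  rw [← Finset.sum_filter, Finset.filter_mem_eq_inter, Finset.inter_eq_right.2 hsub,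
    Finset.sum_const, nsmul_eq_mul]
  linear_combination conj (c l) * a k * h k l

/-- The Schur multiplier with the Fejér weights is contractive. -/
theorem norm_le_of_fejer (b : HilbertBasis ι ℂ E) (d : ι → ℕ) {N : ℕ} (hN : 0 < N)
    {S T : E →L[ℂ] E}
    (h : ∀ k l, (N : ℂ) * inner ℂ (b l) (S (b k)) =
      ((Finset.Ico (d l) (d l + N) ∩ Finset.Ico (d k) (d k + N)).card : ℂ) *
        inner ℂ (b l) (T (b k))) : ‖S‖ ≤ ‖T‖ := by
  classical
  have hN' : (0 : ℝ) < N := by exact_mod_cast hN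
  have hfin : ∀ (s : Finset ι) (a c : ι → ℂ),
      ‖inner ℂ (∑ l ∈ s, c l • b l) (S (∑ k ∈ s, a k • b k))‖ ≤
        ‖T‖ * ‖∑ k ∈ s, a k • b k‖ * ‖∑ l ∈ s, c l • b l‖ := by
    intro s a c
    set R : Finset ℕ := s.biUnion fun k => Finset.Ico (d k) (d k + N) with hRdef
    have hR : ∀ k ∈ s, Finset.Ico (d k) (d k + N) ⊆ R := fun k hk =>
      Finset.subset_biUnion_of_mem (fun k => Finset.Ico (d k) (d k + N)) hk
    have h1 := sum_inner_windowPart b d N s a c h hR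
    have h2 : ‖(N : ℂ) * inner ℂ (∑ l ∈ s, c l • b l) (S (∑ k ∈ s, a k • b k))‖ ≤
        ‖T‖ * ∑ r ∈ R, ‖windowPart b d N s a r‖ * ‖windowPart b d N s c r‖ := by
      rw [h1, Finset.mul_sum]
      refine (norm_sum_le _ _).trans (Finset.sum_le_sum fun r _ => ?_)
      refine (norm_inner_le_norm _ _).trans ?_
      have := T.le_opNorm (windowPart b d N s a r)
      calc _ ≤ ‖windowPart b d N s c r‖ * (‖T‖ * ‖windowPart b d N s a r‖) :=
            mul_le_mul_of_nonneg_left this (norm_nonneg _)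
        _ = _ := by ring
    -- Cauchy–Schwarz over the windows. Each of the two factors brings √N, and the product N cancels
    -- the N multiplying the left side of `h2`.
    have h3 : ∑ r ∈ R, ‖windowPart b d N s a r‖ * ‖windowPart b d N s c r‖ ≤
        N * ‖∑ k ∈ s, a k • b k‖ * ‖∑ l ∈ s, c l • b l‖ := by
      refine le_of_sq_le_sq ((Finset.sum_mul_sq_le_sq_mul_sq _ _ _).trans ?_) (by positivity)
      rw [sum_norm_sq_windowPart b.orthonormal d N s a hR,
        sum_norm_sq_windowPart b.orthonormal d N s c hR]
      exact le_of_eq (by ring)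
    rw [norm_mul, Complex.norm_natCast] at h2
    have h4 := h2.trans (mul_le_mul_of_nonneg_left h3 (norm_nonneg T))
    refine le_of_mul_le_mul_left (h4.trans (le_of_eq ?_)) hN'
    ring
  have hd : DenseRange (Finsupp.linearCombination ℂ b) := by
    have := Submodule.dense_iff_topologicalClosure_eq_top.2 b.dense_span
    rwa [← Finsupp.range_linearCombination, LinearMap.coe_range] at this
  have hall : ∀ u v : E, ‖inner ℂ v (S u)‖ ≤ ‖T‖ * ‖u‖ * ‖v‖ := by
    refine isClosed_property2 hd (isClosed_le (by fun_prop) (by fun_prop)) fun a c => ?_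
    -- Both combinations are written over the union of the supports, since `hfin` needs one common
    -- index set.
    have ha := Finsupp.linearCombination_apply_of_mem_supported ℂ (v := b) (l := a)
      (s := a.support ∪ c.support)
      (Finsupp.mem_supported _ _ |>.2 (by exact_mod_cast Finset.subset_union_left))
    have hc := Finsupp.linearCombination_apply_of_mem_supported ℂ (v := b) (l := c)
      (s := a.support ∪ c.support)
      (Finsupp.mem_supported _ _ |>.2 (by exact_mod_cast Finset.subset_union_right))
    rw [ha, hc]
    exact hfin _ _ _
  refine S.opNorm_le_bound (norm_nonneg _) fun u => ?_
  -- Testing against S u gives ‖S u‖² ≤ ‖T‖ ‖u‖ ‖S u‖, from which one factor is cancelled unless it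
  -- is zero.
  have h1 := hall u (S u)
  rw [inner_self_eq_norm_sq_to_K, norm_pow, RCLike.norm_ofReal, abs_norm, sq] at h1
  rcases (norm_nonneg (S u)).eq_or_lt with h0 | h0
  · rw [← h0]
    positivity
  · exact le_of_mul_le_mul_right h1 h0

end Fejer

end

end FockDomain

namespace FockDomain

noncomputable section

variable {n : ℕ} {H : Type*} [NormedAddCommGroup H] [InnerProductSpace ℂ H] [CompleteSpace H]
  [Nontrivial H] {f : PosRegFreeHol n H} {m : ℕ}

/-! ### Multipliers -/

variable (f m) in
/-- The constant function `1` in `H²`. -/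
def hardyOne : HardySpace f m :=
  (Real.sqrt (gammaCoeff f m 0) : ℂ)⁻¹ • HardySpace.monomialBasis f m 0

theorem hardyOne_apply (x : scalarDomain f) : hardyOne f m x = 1 := by
  rw [hardyOne, HardySpace.smul_apply, HardySpace.monomialBasis_apply, monomialAt_zero, mul_one,
    inv_mul_cancel₀ (sqrt_gammaCoeff_ne_zero f m 0)]

/-- The symbol of a multiplier has to be its value on the constant function 1. This replaces the
existential by equations linear in T. -/
theorem mem_multiplierAlgebra_iff (T : HardySpace f m →L[ℂ] HardySpace f m) :
    T ∈ multiplierAlgebra f m ↔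
      ∀ (ψ : HardySpace f m) (x : scalarDomain f), T ψ x = T (hardyOne f m) x * ψ x := by
  constructor
  · rintro ⟨g, hg⟩ ψ x
    rw [hg, hg, hardyOne_apply, mul_one]
  · exact fun h => ⟨T (hardyOne f m), h⟩

variable (f m) in
-- The kernel of the evaluation at x is closed and invariant under every multiplier. If T preserves
-- it, applying T to ψ - ψ(x)·1 gives (Tψ)(x) = ψ(x)(T1)(x).
theorem isReflexive_multiplierAlgebra : IsReflexive (multiplierAlgebra f m) := by
  apply Set.Subset.antisymm
  · exact fun T hT M hM ψ hψ => hM.2 T hT ψ hψ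
  · intro T hT
    refine (mem_multiplierAlgebra_iff T).2 fun ψ x => ?_
    let M : Submodule ℂ (HardySpace f m) :=
      (HardySpace.evalCLM (m := m) x : HardySpace f m →ₗ[ℂ] ℂ).ker
    have hmem : ∀ φ : HardySpace f m, φ ∈ M ↔ φ x = 0 := fun φ => by
      rw [← HardySpace.evalCLM_apply]
      exact LinearMap.mem_ker
    have hM : M ∈ Lat (multiplierAlgebra f m : Set (HardySpace f m →L[ℂ] HardySpace f m)) := by
      refine ⟨(HardySpace.evalCLM (m := m) x).isClosed_ker, ?_⟩
      rintro A ⟨g, hg⟩ φ hφ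
      rw [hmem] at hφ ⊢
      rw [hg, hφ, mul_zero]
    have h0 : ψ - ψ x • hardyOne f m ∈ M := by
      rw [hmem, ← HardySpace.evalCLM_apply, map_sub, map_smul, HardySpace.evalCLM_apply,
        HardySpace.evalCLM_apply, hardyOne_apply, smul_eq_mul, mul_one, sub_self]
    have h1 := hT M hM _ h0
    rw [hmem, map_sub, map_smul, ← HardySpace.evalCLM_apply, map_sub, map_smul,
      HardySpace.evalCLM_apply, HardySpace.evalCLM_apply, smul_eq_mul, sub_eq_zero] at h1
    rw [h1, mul_comm]

variable (f m) in
-- Point evaluations are bounded, so each equation of `mem_multiplierAlgebra_iff` compares two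
-- weakly continuous functions of T.
theorem isClosed_wot_multiplierAlgebra :
    IsClosed ((ContinuousLinearMapWOT.ofCLM :
      (HardySpace f m →L[ℂ] HardySpace f m) → (HardySpace f m →WOT[ℂ] HardySpace f m)) ''
        (multiplierAlgebra f m : Set _)) := by
  have h : ((ContinuousLinearMapWOT.ofCLM :
      (HardySpace f m →L[ℂ] HardySpace f m) → (HardySpace f m →WOT[ℂ] HardySpace f m)) ''
        (multiplierAlgebra f m : Set _)) =
      ⋂ (ψ : HardySpace f m) (x : scalarDomain f),
        {T : HardySpace f m →WOT[ℂ] HardySpace f m |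
          HardySpace.evalCLM x (T ψ) = HardySpace.evalCLM x (T (hardyOne f m)) * ψ x} := by
    ext T
    simp only [Set.mem_iInter, Set.mem_ofPred_eq, HardySpace.evalCLM_apply]
    constructor
    · rintro ⟨S, hS, rfl⟩
      exact (mem_multiplierAlgebra_iff S).1 hS
    · exact fun hT => ⟨T.toCLM, (mem_multiplierAlgebra_iff _).2 hT, rfl⟩
  rw [h]
  refine isClosed_iInter fun ψ => isClosed_iInter fun x => isClosed_eq ?_ ?_
  · exact ContinuousLinearMapWOT.continuous_dual_apply _ _
  · exact (ContinuousLinearMapWOT.continuous_dual_apply _ _).mul continuous_const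

/-! ### Polynomial multipliers and the Fejér means of a multiplier -/

theorem exists_mem_polynomial_multiplier
    {A : Subalgebra ℂ (HardySpace f m →L[ℂ] HardySpace f m)}
    (hA : ∀ i, ∃ M ∈ A, ∀ (ψ : HardySpace f m) (x : scalarDomain f),
      M ψ x = (x : Fin n → ℂ) i * ψ x) (p : MvPolynomial (Fin n) ℂ) :
    ∃ S ∈ A, ∀ (ψ : HardySpace f m) (x : scalarDomain f),
      S ψ x = MvPolynomial.eval (x : Fin n → ℂ) p * ψ x := by
  induction p using MvPolynomial.induction_on with
  | C a =>
    refine ⟨algebraMap ℂ _ a, A.algebraMap_mem a, fun ψ x => ?_⟩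
    rw [MvPolynomial.eval_C]
    rfl
  | add p q hp hq =>
    obtain ⟨S, hS, hSp⟩ := hp
    obtain ⟨T, hT, hTq⟩ := hq
    refine ⟨S + T, A.add_mem hS hT, fun ψ x => ?_⟩
    rw [_root_.add_apply, HardySpace.add_apply, hSp, hTq, map_add, add_mul]
  | mul_X p i hp =>
    obtain ⟨S, hS, hSp⟩ := hp
    obtain ⟨M, hM, hMi⟩ := hA i
    refine ⟨S * M, A.mul_mem hS hM, fun ψ x => ?_⟩
    have : (S * M) ψ = S (M ψ) := rfl
    rw [this, hSp, hMi, map_mul, MvPolynomial.eval_X, mul_assoc]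

/-- Multiplying by λ^k shifts the power series of the symbol by k. In the monomial basis a
multiplier therefore has, up to the weights √γ, entries depending only on l - k and vanishing unless
k ≤ l. -/
theorem coef_multiplier_monomialBasis {T : HardySpace f m →L[ℂ] HardySpace f m}
    (hT : T ∈ multiplierAlgebra f m) (k l : Fin n →₀ ℕ) :
    HardySpace.coef (T (HardySpace.monomialBasis f m k)) l =
      if k ≤ l then (Real.sqrt (gammaCoeff f m k) : ℂ) *
        HardySpace.coef (T (hardyOne f m)) (l - k) else 0 := by
  classical
  let c : (Fin n →₀ ℕ) → ℂ := fun l => if k ≤ l then (Real.sqrt (gammaCoeff f m k) : ℂ) *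
        HardySpace.coef (T (hardyOne f m)) (l - k) else 0
  have h : HardySpace.coef (T (HardySpace.monomialBasis f m k)) = c := by
    refine HardySpace.coef_eq_of_hasSum _ _ fun x => ?_
    have hinj : Function.Injective (fun l : Fin n →₀ ℕ => k + l) := add_right_injective k
    rw [← hinj.hasSum_iff]
    · have h1 := ((HardySpace.coef_spec (T (hardyOne f m))).hasSum x).mul_left
        ((Real.sqrt (gammaCoeff f m k) : ℂ) * monomialAt (x : Fin n → ℂ) k)
      rw [(mem_multiplierAlgebra_iff T).1 hT, HardySpace.monomialBasis_apply, mul_comm (T _ x)]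
      refine (congrArg (fun F => HasSum F _) (funext fun l => ?_)).mp h1
      simp only [Function.comp_apply, c, le_add_iff_nonneg_right, zero_le, if_true,
        add_tsub_cancel_left, monomialAt_add]
      ring
    · intro l hl
      have : ¬ k ≤ l := fun hkl => hl ⟨l - k, add_tsub_cancel_of_le hkl⟩
      simp [c, this]
  exact congrFun h l

/-- The total degree of a multi-index. -/
def totalDegree (k : Fin n →₀ ℕ) : ℕ := ∑ i, k i

/-- A nonzero (l, k) entry involves only the symbol coefficient at l - k, so weighting the symbol by
degree weights the matrix by the difference of degrees. -/
theorem inner_monomialBasis_fejer {S T : HardySpace f m →L[ℂ] HardySpace f m}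
    (hS : S ∈ multiplierAlgebra f m) (hT : T ∈ multiplierAlgebra f m) {N : ℕ}
    (h : ∀ k, (N : ℂ) * HardySpace.coef (S (hardyOne f m)) k =
      ((N - totalDegree k : ℕ) : ℂ) * HardySpace.coef (T (hardyOne f m)) k)
    (k l : Fin n →₀ ℕ) :
    (N : ℂ) * inner ℂ (HardySpace.monomialBasis f m l) (S (HardySpace.monomialBasis f m k)) =
      ((N - (totalDegree l - totalDegree k) : ℕ) : ℂ) *
        inner ℂ (HardySpace.monomialBasis f m l) (T (HardySpace.monomialBasis f m k)) := by
  simp only [HardySpace.inner_monomialBasis, coef_multiplier_monomialBasis hS,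
    coef_multiplier_monomialBasis hT]
  split_ifs with hkl
  · have hd : totalDegree (l - k) = totalDegree l - totalDegree k := by
      have : totalDegree l = totalDegree k + totalDegree (l - k) := by
        simp only [totalDegree, ← Finset.sum_add_distrib]
        exact Finset.sum_congr rfl fun i _ => by
          have := hkl i
          rw [Finsupp.tsub_apply]
          omega
      omega
    have h1 := h (l - k)
    rw [hd] at h1
    linear_combination (Real.sqrt (gammaCoeff f m k) : ℂ) /
      (Real.sqrt (gammaCoeff f m l) : ℂ) * h1
  · simp

/-- For k ≤ l the one-sided weight N - (|l| - |k|), truncated at 0, is the size of the intersection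
of the two windows. All other entries vanish, so the symmetric weights of `norm_le_of_fejer` are
met. -/
theorem norm_le_of_fejer_multiplier {S T : HardySpace f m →L[ℂ] HardySpace f m}
    (hS : S ∈ multiplierAlgebra f m) (hT : T ∈ multiplierAlgebra f m) {N : ℕ} (hN : 0 < N)
    (h : ∀ k, (N : ℂ) * HardySpace.coef (S (hardyOne f m)) k =
      ((N - totalDegree k : ℕ) : ℂ) * HardySpace.coef (T (hardyOne f m)) k) : ‖S‖ ≤ ‖T‖ := by
  refine norm_le_of_fejer (HardySpace.monomialBasis f m) totalDegree hN fun k l => ?_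
  rw [inner_monomialBasis_fejer hS hT h]
  by_cases hkl : k ≤ l
  · have hd : totalDegree k ≤ totalDegree l := Finset.sum_le_sum fun i _ => hkl i
    congr 2
    rw [Finset.Ico_inter_Ico, Nat.card_Ico]
    simp only [Nat.max_def, Nat.min_def]
    split_ifs <;> omega
  · have h0 : inner ℂ (HardySpace.monomialBasis f m l) (T (HardySpace.monomialBasis f m k)) = 0 := by
      rw [HardySpace.inner_monomialBasis, coef_multiplier_monomialBasis hT, if_neg hkl, zero_div]
    rw [h0, mul_zero, mul_zero]

/-- The multipliers with the Fejér-weighted symbol of a given multiplier are polynomials in the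
coordinate multipliers. -/
theorem exists_mem_fejer {A : Subalgebra ℂ (HardySpace f m →L[ℂ] HardySpace f m)}
    (hA : ∀ i, ∃ M ∈ A, ∀ (ψ : HardySpace f m) (x : scalarDomain f),
      M ψ x = (x : Fin n → ℂ) i * ψ x) (T : HardySpace f m →L[ℂ] HardySpace f m)
    {N : ℕ} (hN : 0 < N) :
    ∃ S ∈ A, S ∈ multiplierAlgebra f m ∧ ∀ k, (N : ℂ) * HardySpace.coef (S (hardyOne f m)) k =
      ((N - totalDegree k : ℕ) : ℂ) * HardySpace.coef (T (hardyOne f m)) k := by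
  classical
  have hN' : (N : ℂ) ≠ 0 := by exact_mod_cast hN.ne'
  let c : (Fin n →₀ ℕ) → ℂ := fun k =>
    ((N - totalDegree k : ℕ) : ℂ) / N * HardySpace.coef (T (hardyOne f m)) k
  -- The truncated weight N - |k| vanishes from degree N on, so the multi-indices of degree below N
  -- suffice and the symbol is a polynomial.
  let F : Finset (Fin n →₀ ℕ) :=
    (Finset.range N).biUnion fun d => Finset.univ.finsuppAntidiag d
  have hF : ∀ k ∉ F, c k = 0 := by
    intro k hk
    have : N ≤ totalDegree k := by
      by_contra! hlt
      exact hk (Finset.mem_biUnion.2 ⟨totalDegree k, Finset.mem_range.2 hlt, by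
        simp [Finset.mem_finsuppAntidiag, totalDegree]⟩)
    simp [c, Nat.sub_eq_zero_of_le this]
  obtain ⟨S, hSA, hS⟩ := exists_mem_polynomial_multiplier hA (∑ k ∈ F, MvPolynomial.monomial k (c k))
  refine ⟨S, hSA, ⟨_, hS⟩, fun k => ?_⟩
  have hcoef : HardySpace.coef (S (hardyOne f m)) = c := by
    refine HardySpace.coef_eq_of_hasSum _ _ fun x => ?_
    rw [hS, hardyOne_apply, mul_one, map_sum]
    simp only [MvPolynomial.eval_monomial, Finsupp.prod_fintype _ _ (fun _ => pow_zero _)]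
    exact hasSum_sum_of_ne_finset_zero fun k hk => by rw [hF k hk, zero_mul]
  rw [hcoef]
  simp only [c]
  field_simp

theorem tendsto_fejer_weight (e : ℕ) :
    Tendsto (fun N : ℕ => ((N + 1 - e : ℕ) : ℂ) / ((N + 1 : ℕ) : ℂ)) atTop (𝓝 1) := by
  have h1 : Tendsto (fun N : ℕ => 1 - (e : ℂ) * (1 / ((N : ℂ) + 1))) atTop (𝓝 1) := by
    simpa using (tendsto_one_div_add_atTop_nhds_zero_nat (𝕜 := ℂ)).const_mul (e : ℂ) |>.const_sub 1
  refine h1.congr' ?_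
  filter_upwards [eventually_ge_atTop e] with N hN
  have hN' : (N : ℂ) + 1 ≠ 0 := by exact_mod_cast N.succ_ne_zero
  rw [Nat.cast_sub (by omega)]
  push_cast
  field_simp

/-- The Fejér means of T lie in A, have norm at most ‖T‖, and each matrix entry is that of T times a
weight tending to 1. They converge to T in the weak operator topology. The N-th mean is taken of
order N + 1 to keep the denominators nonzero. -/
theorem mem_of_isClosed_wot {A : Subalgebra ℂ (HardySpace f m →L[ℂ] HardySpace f m)}
    (hA : ∀ i, ∃ M ∈ A, ∀ (ψ : HardySpace f m) (x : scalarDomain f),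
      M ψ x = (x : Fin n → ℂ) i * ψ x)
    (hcl : IsClosed ((ContinuousLinearMapWOT.ofCLM :
      (HardySpace f m →L[ℂ] HardySpace f m) → (HardySpace f m →WOT[ℂ] HardySpace f m)) ''
        (A : Set _)))
    {T : HardySpace f m →L[ℂ] HardySpace f m} (hT : T ∈ multiplierAlgebra f m) : T ∈ A := by
  choose S hSA hS hfejer using fun N : ℕ => exists_mem_fejer hA T N.succ_pos
  have hlim : ∀ u v : HardySpace f m,
      Tendsto (fun N => inner ℂ v (S N u)) atTop (𝓝 (inner ℂ v (T u))) := by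
    refine tendsto_inner_of_tendsto_basis (HardySpace.monomialBasis f m) (C := ‖T‖)
      (fun N => norm_le_of_fejer_multiplier (hS N) hT N.succ_pos (hfejer N)) fun k l => ?_
    have h1 := (tendsto_fejer_weight (totalDegree l - totalDegree k)).mul_const
      (inner ℂ (HardySpace.monomialBasis f m l) (T (HardySpace.monomialBasis f m k)))
    rw [one_mul] at h1
    refine h1.congr fun N => ?_
    have h2 := inner_monomialBasis_fejer (hS N) hT (hfejer N) k l
    have hN' : ((N + 1 : ℕ) : ℂ) ≠ 0 := by exact_mod_cast N.succ_ne_zero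
    rw [div_mul_eq_mul_div, div_eq_iff hN', ← h2, mul_comm]
  have hwot : Tendsto (fun N => (ContinuousLinearMapWOT.ofCLM (S N) :
      HardySpace f m →WOT[ℂ] HardySpace f m)) atTop (𝓝 (ContinuousLinearMapWOT.ofCLM T)) :=
    ContinuousLinearMapWOT.tendsto_iff_forall_inner_apply_tendsto.2 hlim
  obtain ⟨T', hT', hTT'⟩ := hcl.mem_of_tendsto hwot
    (Eventually.of_forall fun N => Set.mem_image_of_mem _ (hSA N))
  rwa [← ContinuousLinearMapWOT.ofCLM_injective hTT']

theorem multiplierAlgebra_eq_wotClosedAlgebra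
    (M : Fin n → HardySpace f m →L[ℂ] HardySpace f m)
    (hM : ∀ (i : Fin n) (ψ : HardySpace f m) (x : scalarDomain f),
      M i ψ x = (x : Fin n → ℂ) i * ψ x) :
    multiplierAlgebra f m = wotClosedAlgebra (Set.range M) := by
  apply le_antisymm
  · refine le_sInf fun A hA T hT => ?_
    exact mem_of_isClosed_wot (fun i => ⟨M i, hA.1 ⟨i, rfl⟩, hM i⟩) hA.2 hT
  -- The multiplier algebra is itself one of the algebras in the infimum.
  · refine sInf_le ⟨?_, isClosed_wot_multiplierAlgebra f m⟩
    rintro _ ⟨i, rfl⟩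
    exact ⟨fun x => (x : Fin n → ℂ) i, hM i⟩

end

end FockDomain

open FockDomain
theorem theorem4p5 {n m : ℕ} (hn : 1 ≤ n) (hm : 1 ≤ m)
    {H : Type*} [NormedAddCommGroup H] [InnerProductSpace ℂ H] [CompleteSpace H] [Nontrivial H]
    (f : PosRegFreeHol n H) :
    ∃ U : symFock f m ≃ₗᵢ[ℂ] HardySpace f m,
      -- `U` is the functional representation `φ(λ) = ⟨φ, z_λ⟩`, `z_λ = ∑_α √b_α conj(λ_α) e_α`
      (∀ (φ : symFock f m) (x : scalarDomain f),
        HasSum (fun α : Word n => (φ : Fock n) α *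
          ((Real.sqrt (bCoeff f m α) : ℂ) * evalWord (x : Fin n → ℂ) α)) (U φ x)) ∧
      -- `L_i` is the multiplier by the coordinate function `λ_i`
      (∀ (i : Fin n) (φ : symFock f m) (x : scalarDomain f),
        U (symShift f m i φ) x = (x : Fin n → ℂ) i * U φ x) ∧
      IsReflexive (multiplierAlgebra f m) ∧
      multiplierAlgebra f m = wotClosedAlgebra (Set.range fun i : Fin n =>
        (U.toContinuousLinearEquiv : symFock f m →L[ℂ] HardySpace f m) ∘L symShift f m i ∘L
          (U.symm.toContinuousLinearEquiv : HardySpace f m →L[ℂ] symFock f m)) := by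
  refine ⟨functionalRep f m, hasSum_functionalRep f m, functionalRep_symShift f m,
    isReflexive_multiplierAlgebra f m, multiplierAlgebra_eq_wotClosedAlgebra _ fun i ψ x => ?_⟩
  change functionalRep f m (symShift f m i ((functionalRep f m).symm ψ)) x = _
  rw [functionalRep_symShift, LinearIsometryEquiv.apply_symm_apply]
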